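/- **Definitions.** *Espaliers.* Let $(L,\leq)$ be a nonempty partially ordered set, $\perp$ a binary relation on $L$ and $\sim$ an equivalence relation on $L$. Write $c=a\oplus b$ if $a\perp b$ and $c$ is the supremum of $\{a,b\}$; $0$ denotes the smallest element of $L$ (it exists by (L1) below). Finite sums $\bigoplus_{i\in J}a_i$ are defined by iterating $\oplus$, the empty sum being $0$. A family $(a_i)_{i\in I}$ is *orthogonal* if it has an upper bound and $\bigoplus_{i\in J}a_i$ is defined for every finite $J\subseteq I$; then $\bigoplus_{i\in I}a_i$ is $\bigvee_{i\in I}a_i$. The structure $(L,\leq,\perp,\sim)$ is an *espalier* if: - (L1) every nonempty subset of $L$ has an infimum; - (L2) for all $a,b,c\in L$: (i) $a\perp 0$; (ii) $a\perp b$ implies $b\perp a$; (iii) $a\leq b$ and $b\perp c$ imply $a\perp c$; (iv) if $\{a,b,c\}$ has an upper bound, $a\perp b$ and $(a\vee b)\perp c$, then $a\perp(b\vee c)$; (v) $a\perp a$ implies $a=0$; - (L3) if $a\leq b$, then $a\oplus x=b$ for some $x\in L$; - (L4) if $(b_i)_{i\in I}$ is orthogonal and $a\perp\bigoplus_{i\in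 J}b_i$ for all finite $J\subseteq I$, then $a\perp\bigoplus_{i\in I}b_i$; - (L5) $x\sim 0$ implies $x=0$; - (L6) if $(b_i)_{i\in I}$ is orthogonal and $a\sim\bigoplus_{i\in I}b_i$, then $a=\bigoplus_{i\in I}a_i$ for some orthogonal family $(a_i)_{i\in I}$ with $a_i\sim b_i$ for all $i\in I$; - (L7) if $(a_i)_{i\in I}$ and $(b_i)_{i\in I}$ are orthogonal and $a_i\sim b_i$ for all $i\in I$, then $\bigoplus_{i\in I}a_i\sim\bigoplus_{i\in I}b_i$; - (L8) if $a\vee b$ exists, $(a\wedge b)\oplus x=a$ and $b\oplus y=a\vee b$, then $x\sim y$. *Partial commutative monoids.* A partial commutative monoid $(S,+,0)$ is a set $S$ with a partial binary operation $+$ that is associative and commutative (each time, one side is defined if and only if the other one is, and then they are equal) and an element $0$ with $a+0=a$ for all $a$. Put $a\leq b$ if $a+x=b$ for some $x$. For $a,b\in S$ write $a\perp b$ if $x\leq a,b$ implies $x=0$; $X^\perp$ is the set of all $s\in S$ with $s\perp x$ for all $x\in X$, and $x^\perp=\{x\}^\perp$. A *projection* of $S$ is an endomorphism $p$ of $(S,+,0)$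 such that every $x\in S$ is of the form $p(x)+y$ with $y\in(pS)^\perp$; $p^\perp$ is the projection with $p^\perp S=(pS)^\perp$ and $(p^\perp)^{-1}\{0\}=pS$. Projections are ordered by $q\leq p$ if and only if $q\circ p=q$. An element $c$ is *directly finite* if $x+c=c$ implies $x=0$, and *purely infinite* if $c+c=c$. Write $a\ll_{\mathrm{rem}}b$ if $a\leq b$ and, for all $x$ such that $a+x$ is defined, $b\leq a+x$ implies $b\leq x$. A partial commutative monoid $S$ is a *continuous dimension scale* if: - (M1) $S$ has refinement (if $a_0+a_1=b_0+b_1$, then there are $c_{ij}\in S$, $i,j<2$, with $a_i=c_{i0}+c_{i1}$ and $b_i=c_{0i}+c_{1i}$ for $i<2$), and $\leq$ is antisymmetric; - (M2) every nonempty subset of $S$ has an infimum for $\leq$; - (M3) for all $x,y\in S$ there is a projection $p$ with $p(x)\leq p(y)$ and $p^\perp(y)\leq p^\perp(x)$; - (M4) for all $a,b\in S$ there is a largest projection $p$ with $p(a)\leq p(b)$; - (M5) every $a\in S$ is of the form $x+y$ with $x$ directly finite and $y$ purely infinite; - (M6) if $a,b\in S$ are purely infinite and $a\ll_{\mathrm{rem}}b$,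 then the set of all purely infinite $x\in S$ with $a\ll_{\mathrm{rem}}x$ and $x^\perp=b^\perp$ has a least element. **Theorem A.** Let $(L,\leq,\perp,\sim)$ be an espalier, and let $\Delta(a)$ denote the $\sim$-class of $a\in L$. For $\alpha,\beta,\gamma\in L/{\sim}$ put $\gamma=\alpha+\beta$ if there are $a,b,c\in L$ with $\alpha=\Delta(a)$, $\beta=\Delta(b)$, $\gamma=\Delta(c)$ and $c=a\oplus b$. Then $+$ is a well-defined partial operation on $L/{\sim}$, and $(L/{\sim},+,\Delta(0))$ is a continuous dimension scale. -/

import Mathlib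

universe u

section Espaliers

/-- `c = a ⊕ b`: `a` and `b` are orthogonal and `c` is the supremum of `{a, b}`. -/
def IsOplus {L : Type u} [PartialOrder L] (perp : L → L → Prop) (a b c : L) : Prop :=
  perp a b ∧ IsLUB {a, b} c

/-- `IsFinOplus perp a J c` says that the iterated partial sum `⊕_{i ∈ J} a i` over the finite
index set `J` is defined and equal to `c`: the empty sum is the smallest element, and
`⊕_{i ∈ J ∪ {j}} a i = (⊕_{i ∈ J} a i) ⊕ a j` for `j ∉ J`. -/
inductive IsFinOplus {L : Type u} [PartialOrder L] (perp : L → L → Prop) {I : Type u}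
    (a : I → L) : Finset I → L → Prop
  | empty {z : L} (hz : IsBot z) : IsFinOplus perp a ∅ z
  | cons {J : Finset I} {j : I} (hj : j ∉ J) {b c : L} (hb : IsFinOplus perp a J b)
      (hc : IsOplus perp b (a j) c) : IsFinOplus perp a (Finset.cons j J hj) c

/-- A family is orthogonal if it is majorized and all its finite partial sums are defined. -/
def IsOrthFamily {L : Type u} [PartialOrder L] (perp : L → L → Prop) {I : Type u}
    (a : I → L) : Prop :=
  BddAbove (Set.range a) ∧ ∀ J : Finset I, ∃ c, IsFinOplus perp a J c

/-- `c = ⊕_{i ∈ I} a i`: the family `a` is orthogonal and `c` is its supremum. -/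
def IsFamOplus {L : Type u} [PartialOrder L] (perp : L → L → Prop) {I : Type u}
    (a : I → L) (c : L) : Prop :=
  IsOrthFamily perp a ∧ IsLUB (Set.range a) c

/-- The structure `(L, ≤, perp, sim)` is an espalier. The smallest element `0` of `L` exists by
`nonempty` and `exists_inf`; it is referred to as any `z` with `IsBot z`. Two distinct indices of
an orthogonal family never carry the same nonzero element, so index types in the universe of `L`
account for all orthogonal families. -/
structure IsEspalier {L : Type u} [PartialOrder L] (perp : L → L → Prop) (sim : Setoid L) :
    Prop where
  nonempty : Nonempty L
  /-- (L1) -/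
  exists_inf : ∀ X : Set L, X.Nonempty → ∃ m, IsGLB X m
  /-- (L2)(i) -/
  perp_zero : ∀ a z : L, IsBot z → perp a z
  /-- (L2)(ii) -/
  perp_symm : ∀ a b : L, perp a b → perp b a
  /-- (L2)(iii) -/
  perp_of_le : ∀ a b c : L, a ≤ b → perp b c → perp a c
  /-- (L2)(iv) -/
  perp_assoc : ∀ a b c ab bc : L, BddAbove {a, b, c} → perp a b →
    IsLUB {a, b} ab → IsLUB {b, c} bc → perp ab c → perp a bc
  /-- (L2)(v) -/
  eq_zero_of_perp_self : ∀ a : L, perp a a → IsBot a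
  /-- (L3) -/
  exists_oplus : ∀ a b : L, a ≤ b → ∃ x, IsOplus perp a x b
  /-- (L4) -/
  perp_famOplus : ∀ (a : L) (I : Type u) (b : I → L) (c : L), IsFamOplus perp b c →
    (∀ (J : Finset I) (d : L), IsFinOplus perp b J d → perp a d) → perp a c
  /-- (L5) -/
  eq_zero_of_sim : ∀ x z : L, IsBot z → sim x z → x = z
  /-- (L6) unrestricted refinement -/
  sim_refine : ∀ (a : L) (I : Type u) (b : I → L) (c : L), IsFamOplus perp b c → sim a c →
    ∃ a' : I → L, IsFamOplus perp a' a ∧ ∀ i, sim (a' i) (b i)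
  /-- (L7) unrestricted additivity -/
  sim_add : ∀ (I : Type u) (a b : I → L) (c d : L), IsFamOplus perp a c → IsFamOplus perp b d →
    (∀ i, sim (a i) (b i)) → sim c d
  /-- (L8) parallelogram rule -/
  parallelogram : ∀ a b x y m j : L, IsGLB {a, b} m → IsLUB {a, b} j →
    IsOplus perp m x a → IsOplus perp b y j → sim x y

/-- The partial addition of the quotient of `L` by `sim`, as a ternary relation:
`γ = α + β` if there are representatives with `c = a ⊕ b`. -/
def dimAdd {L : Type u} [PartialOrder L] (perp : L → L → Prop) (sim : Setoid L)
    (α β γ : Quotient sim) : Prop :=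
  ∃ a b c : L, α = Quotient.mk sim a ∧ β = Quotient.mk sim b ∧ γ = Quotient.mk sim c ∧
    IsOplus perp a b c

end Espaliers

/-! A partial binary operation on `S` is given by its graph `add : S → S → S → Prop`, where
`add a b c` reads: the sum `a + b` is defined and equal to `c`. -/

namespace PartialMon

/-- `(S, add, zero)` is a partial commutative monoid. -/
structure IsPartialCommMonoid {S : Type u} (add : S → S → S → Prop) (zero : S) : Prop where
  /-- the graph is that of a partial function -/
  unique : ∀ a b c c' : S, add a b c → add a b c' → c = c'
  assoc : ∀ a b c d : S, (∃ x, add a b x ∧ add x c d) ↔ (∃ y, add b c y ∧ add a y d)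
  comm : ∀ a b c : S, add a b c ↔ add b a c
  add_zero : ∀ a : S, add a zero a

/-- The algebraic preordering. -/
def AlgLE {S : Type u} (add : S → S → S → Prop) (a b : S) : Prop :=
  ∃ x, add a x b

/-- The refinement property. -/
def HasRefinement {S : Type u} (add : S → S → S → Prop) : Prop :=
  ∀ a₀ a₁ b₀ b₁ s : S, add a₀ a₁ s → add b₀ b₁ s →
    ∃ c₀₀ c₀₁ c₁₀ c₁₁ : S, add c₀₀ c₀₁ a₀ ∧ add c₁₀ c₁₁ a₁ ∧ add c₀₀ c₁₀ b₀ ∧ add c₀₁ c₁₁ b₁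

/-- Orthogonality of elements of a partial commutative monoid. -/
def Orth {S : Type u} (add : S → S → S → Prop) (zero a b : S) : Prop :=
  ∀ x : S, AlgLE add x a → AlgLE add x b → x = zero

/-- The set of all elements orthogonal to every element of `X`. -/
def orthSet {S : Type u} (add : S → S → S → Prop) (zero : S) (X : Set S) : Set S :=
  {s | ∀ x ∈ X, Orth add zero s x}

/-- A projection: an endomorphism `p` of the partial monoid such that every `x` lies in
`p x + (p S)^⊥`. -/
structure IsProjection {S : Type u} (add : S → S → S → Prop) (zero : S) (p : S → S) : Prop where
  map_zero : p zero = zero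
  map_add : ∀ a b c : S, add a b c → add (p a) (p b) (p c)
  decomp : ∀ x : S, ∃ y ∈ orthSet add zero (Set.range p), add (p x) y x

/-- `q = p^⊥`: the projection with range `(p S)^⊥` and kernel `p S`. -/
def IsComplProjection {S : Type u} (add : S → S → S → Prop) (zero : S) (p q : S → S) : Prop :=
  IsProjection add zero q ∧ Set.range q = orthSet add zero (Set.range p) ∧
    {x | q x = zero} = Set.range p

/-- General comparability. -/
def HasGeneralComparability {S : Type u} (add : S → S → S → Prop) (zero : S) : Prop :=
  ∀ x y : S, ∃ p q : S → S, IsProjection add zero p ∧ IsComplProjection add zero p q ∧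
    AlgLE add (p x) (p y) ∧ AlgLE add (q y) (q x)

/-- Boolean-valued: for all `a`, `b` there is a largest projection `p` with `p a ≤ p b`, where
projections are ordered by `q ≤ p` if and only if `q ∘ p = q`. -/
def IsBooleanValued {S : Type u} (add : S → S → S → Prop) (zero : S) : Prop :=
  ∀ a b : S, ∃ p : S → S, IsProjection add zero p ∧ AlgLE add (p a) (p b) ∧
    ∀ q : S → S, IsProjection add zero q → AlgLE add (q a) (q b) → q ∘ p = q

/-- `c` is directly finite. -/
def IsDirectlyFinite {S : Type u} (add : S → S → S → Prop) (zero c : S) : Prop :=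
  ∀ x : S, add x c c → x = zero

/-- `a` is purely infinite: `a + a = a`. -/
def IsPurelyInfinite {S : Type u} (add : S → S → S → Prop) (a : S) : Prop :=
  add a a a

/-- `a` is removable from `b`: `a ≤ b`, and `b ≤ a + x` implies `b ≤ x`. -/
def IsRemovable {S : Type u} (add : S → S → S → Prop) (a b : S) : Prop :=
  AlgLE add a b ∧ ∀ x s : S, add a x s → AlgLE add b s → AlgLE add b x

/-- `(S, add, zero)` is a continuous dimension scale. -/
structure IsContinuousDimensionScale {S : Type u} (add : S → S → S → Prop) (zero : S) : Prop
    extends IsPartialCommMonoid add zero where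
  /-- (M1), first half -/
  refinement : HasRefinement add
  /-- (M1), second half -/
  antisymm : ∀ a b : S, AlgLE add a b → AlgLE add b a → a = b
  /-- (M2) -/
  exists_inf : ∀ X : Set S, X.Nonempty →
    ∃ m, (∀ x ∈ X, AlgLE add m x) ∧ ∀ n, (∀ x ∈ X, AlgLE add n x) → AlgLE add n m
  /-- (M3) -/
  generalComparability : HasGeneralComparability add zero
  /-- (M4) -/
  booleanValued : IsBooleanValued add zero
  /-- (M5) -/
  exists_decomp : ∀ a : S, ∃ x y : S, add x y a ∧ IsDirectlyFinite add zero x ∧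
    IsPurelyInfinite add y
  /-- (M6) -/
  exists_least : ∀ a b : S, IsPurelyInfinite add a → IsPurelyInfinite add b →
    IsRemovable add a b →
    ∃ m ∈ {x : S | IsPurelyInfinite add x ∧ IsRemovable add a x ∧
        orthSet add zero {x} = orthSet add zero {b}},
      ∀ x ∈ {x : S | IsPurelyInfinite add x ∧ IsRemovable add a x ∧
        orthSet add zero {x} = orthSet add zero {b}}, AlgLE add m x

end PartialMon

/-! Adjoin to the set of classes a top element that stands for an undefined sum. This gives a total
commutative monoid `T` in which every family has a sum. What the espalier axioms provide is then
condensed into a few properties of `T`: the algebraic order is antisymmetric, refinement holds below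
the top, an element orthogonal to all terms of a family is orthogonal to its sum, and exhaustion
holds. Exhaustion is the main tool: given elements `c k` below the top and any property `P`, a
maximal common family `t` of elements with `P` yields `c k = sum t + r k`, and no nonzero element
with `P` lies below all `r k`. In the espalier, `sim_refine` and `sim_add` make sums of classes well
defined and realizable inside any representative of the total, `parallelogram` gives refinement, a
Cantor-Bernstein argument gives antisymmetry, and Zorn's lemma gives exhaustion.

The rest takes place in `T`. Exhaustion splits every element below the top into components in a band
`oc X` and in its complement `oc (oc X)`; the component maps `off X` are exactly the projections of
the scale. Enlarging `X` shrinks the band. Exhausting two elements by common parts leaves orthogonal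
remainders, hence general comparability. Since an inequality may be checked on a dense set of bands
(`le_of_dense`), a failure of `x ≤ y` yields a nonzero band on which `y ≤ x` while `x ≤ y` fails on
every nonzero subband (`exists_nowhere_le`); most later arguments are localized to such a band.

Exhaustion by purely infinite elements splits off a directly finite part. Exhausting all elements of
a set at once produces its infimum, because directly finite elements cancel
(`DFin.le_of_add_eq_add`). For the least element above which `a` is removable, a minimal-cardinality
argument shows that infima of purely infinite elements are locally attained (`exists_local_min`). -/

/-- A commutative monoid with sums of arbitrary families. -/
class SumMonoid (T : Type u) extends AddCommMonoid T where
  sum : ∀ {I : Type u}, (I → T) → T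
  sum_equiv : ∀ {I J : Type u} (e : I ≃ J) (f : J → T), sum (fun i => f (e i)) = sum f
  sum_sigma : ∀ {I : Type u} {J : I → Type u} (f : (Σ i, J i) → T),
    sum (fun i => sum fun j => f ⟨i, j⟩) = sum f
  sum_punit : ∀ a : T, sum (fun _ : PUnit.{u + 1} => a) = a
  sum_bool : ∀ a b : T, sum (fun i : ULift.{u} Bool => cond i.down a b) = a + b

namespace SumMonoid

variable {T : Type u} [SumMonoid T]

/-! ### Sums -/

theorem sum_congr_equiv {I J : Type u} (e : I ≃ J) {f : I → T} {g : J → T}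
    (h : ∀ i, f i = g (e i)) : sum f = sum g := by
  rw [← sum_equiv e g]
  exact congrArg sum (funext h)

theorem sum_unique {I : Type u} [Unique I] (f : I → T) : sum f = f default := by
  rw [← sum_punit (f default)]
  exact sum_congr_equiv (Equiv.ofUnique I PUnit) fun i => by rw [Unique.eq_default i]

theorem sum_split {I : Type u} (p : I → Prop) (f : I → T) :
    sum f = sum (fun i : {i // p i} => f i) + sum (fun i : {i // ¬ p i} => f i) := by
  classical
  let g : I → ULift.{u} Bool := fun i => ⟨decide (p i)⟩
  rw [← sum_congr_equiv (Equiv.sigmaFiberEquiv g) (f := fun x => f x.2) (fun _ => rfl),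
    ← sum_sigma, ← sum_bool]
  congr 1
  funext ⟨b⟩
  cases b
  · exact sum_congr_equiv (Equiv.subtypeEquivRight fun i => by simp [g, ULift.ext_iff])
      fun _ => rfl
  · exact sum_congr_equiv (Equiv.subtypeEquivRight fun i => by simp [g, ULift.ext_iff])
      fun _ => rfl

theorem sum_fiber {I J : Type u} (g : I → J) (f : I → T) :
    sum f = sum fun j => sum fun i : {i // g i = j} => f i := by
  rw [← sum_congr_equiv (Equiv.sigmaFiberEquiv g) (f := fun x => f x.2) (fun _ => rfl),
    ← sum_sigma]

theorem sum_empty {I : Type u} [IsEmpty I] (f : I → T) : sum f = 0 := by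
  -- Splitting a one-term sum with value `0` leaves `0 = 0 + (empty sum)`.
  have h := sum_split (fun _ => True) (fun _ : PUnit.{u + 1} => (0 : T))
  rw [sum_punit] at h
  have h2 : sum (fun i : {i : PUnit.{u + 1} // ¬ True} => (0 : T)) = 0 := by
    have : Unique {i : PUnit.{u + 1} // True} := ⟨⟨⟨⟨⟩, trivial⟩⟩, fun _ => rfl⟩
    rw [sum_unique (I := {i : PUnit.{u + 1} // True}), zero_add] at h
    exact h.symm
  rw [← h2]
  have : IsEmpty {i : PUnit.{u + 1} // ¬ True} := ⟨fun x => x.2 trivial⟩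
  exact sum_congr_equiv (Equiv.equivOfIsEmpty _ _) fun i => isEmptyElim i

theorem sum_option {I : Type u} (f : Option I → T) :
    sum f = f none + sum fun i => f (some i) := by
  rw [sum_split (fun i => i = none) f]
  congr 1
  · rw [sum_unique]; rfl
  · exact (sum_congr_equiv (Equiv.optionIsSomeEquiv I |>.symm.trans
      (Equiv.subtypeEquivRight fun i => Option.isSome_iff_ne_none)) fun i => rfl).symm

theorem sum_add {I : Type u} (f g : I → T) : sum (fun i => f i + g i) = sum f + sum g := by
  rw [← sum_bool]
  have h1 : (fun i => f i + g i) =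
      fun i => sum fun b : ULift.{u} Bool => (fun x : Σ _ : I, ULift.{u} Bool =>
        cond x.2.down (f x.1) (g x.1)) ⟨i, b⟩ := by
    funext i; exact (sum_bool _ _).symm
  have h2 : (fun i : ULift.{u} Bool => cond i.down (sum f) (sum g)) =
      fun b => sum fun i : I => (fun x : Σ _ : ULift.{u} Bool, I =>
        cond x.1.down (f x.2) (g x.2)) ⟨b, i⟩ := by
    funext ⟨b⟩; cases b <;> rfl
  rw [h1, h2, sum_sigma (fun x : Σ _ : I, ULift.{u} Bool => cond x.2.down (f x.1) (g x.1)),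
    sum_sigma (fun x : Σ _ : ULift.{u} Bool, I => cond x.1.down (f x.2) (g x.2))]
  exact sum_congr_equiv ⟨fun x => ⟨x.2, x.1⟩, fun x => ⟨x.2, x.1⟩, fun _ => rfl, fun _ => rfl⟩
    fun _ => rfl

theorem sum_const_prod {I J : Type u} (a : T) :
    sum (fun _ : I => sum fun _ : J => a) = sum fun _ : I × J => a := by
  rw [sum_sigma (fun _ : Σ _ : I, J => a)]
  exact sum_congr_equiv (Equiv.sigmaEquivProd I J) fun _ => rfl

theorem sum_const_add_self {I : Type u} [Infinite I] (a : T) :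
    (sum fun _ : I => a) + (sum fun _ : I => a) = sum fun _ : I => a := by
  rw [← sum_add]
  have h : (fun _ : I => a + a) = fun _ : I => sum fun _ : ULift.{u} Bool => a := by
    funext i
    rw [← sum_bool]
    congr 1
    funext ⟨b⟩; cases b <;> rfl
  rw [h, sum_const_prod]
  have : Nonempty (I × ULift.{u} Bool ≃ I) := by
    rw [← Cardinal.eq]
    simpa using Cardinal.mul_eq_left (Cardinal.aleph0_le_mk I)
      ((Cardinal.natCast_le_aleph0 (n := 2)).trans (Cardinal.aleph0_le_mk I)) two_ne_zero
  exact sum_congr_equiv this.some fun _ => rfl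

/-- The Cantor-Bernstein theorem. -/
theorem eq_of_add_eq_of_add_eq
    (h : ∀ a z : T, a + z = a → ∃ r, a = sum (fun _ : ULift.{u} ℕ => z) + r) {a b x y : T}
    (hx : a + x = b) (hy : b + y = a) : a = b := by
  -- Here `a` absorbs `x + y`, so it contains countably many copies of `x`; these absorb one more
  -- copy, so `a + x = a`.
  obtain ⟨r, hr⟩ := h a (x + y) (by rw [← add_assoc, hx, hy])
  have e : Nonempty (Option (ULift.{u} ℕ) ≃ ULift.{u} ℕ) := by
    rw [← Cardinal.eq]
    simp
  have hs : (sum fun _ : ULift.{u} ℕ => x) = x + sum fun _ : ULift.{u} ℕ => x :=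
    (sum_congr_equiv e.some (f := fun _ => x) (fun _ => rfl)).symm.trans (sum_option _)
  rw [sum_add] at hr
  rw [← hx, hr]
  conv_lhs => rw [hs]
  abel

end SumMonoid

/-! ### Dimension monoids: axioms and elementary properties of the order -/

open SumMonoid in
/-- A commutative monoid with its algebraic order, an absorbing top element standing for an
undefined sum, and sums of arbitrary families, such that refinement holds below the top and
elements can be exhausted by orthogonal families. -/
class DimensionMonoid (T : Type u) extends SumMonoid T, PartialOrder T, OrderTop T where
  le_iff_exists_add' : ∀ a b : T, a ≤ b ↔ ∃ c, b = a + c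
  add_top' : ∀ a : T, a + ⊤ = ⊤
  refinement : ∀ a₀ a₁ b₀ b₁ : T, a₀ + a₁ = b₀ + b₁ → a₀ + a₁ ≠ ⊤ →
    ∃ c₀₀ c₀₁ c₁₀ c₁₁ : T, c₀₀ + c₀₁ = a₀ ∧ c₁₀ + c₁₁ = a₁ ∧ c₀₀ + c₁₀ = b₀ ∧ c₀₁ + c₁₁ = b₁
  eq_zero_of_le_sum : ∀ {I : Type u} (f : I → T) (z : T), sum f ≠ ⊤ → z ≤ sum f →
    (∀ i x, x ≤ z → x ≤ f i → x = 0) → z = 0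
  exhaustion : ∀ {K : Type u} [Nonempty K] (c : K → T), (∀ k, c k ≠ ⊤) → ∀ P : T → Prop,
    ∃ (I : Type u) (t : I → T) (r : K → T), (∀ i, P (t i)) ∧ (∀ k, c k = sum t + r k) ∧
      ∀ x, P x → (∀ k, x ≤ r k) → x = 0

namespace DimensionMonoid

open SumMonoid

variable {T : Type u} [DimensionMonoid T]

instance : CanonicallyOrderedAdd T where
  exists_add_of_le := fun h => (le_iff_exists_add' _ _).1 h
  le_add_self := fun _ b => (le_iff_exists_add' _ _).2 ⟨b, add_comm _ _⟩
  le_self_add := fun _ b => (le_iff_exists_add' _ _).2 ⟨b, rfl⟩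

instance : IsOrderedAddMonoid T where
  add_le_add_left := fun _ _ h _ => by
    obtain ⟨d, rfl⟩ := exists_add_of_le h
    exact (le_iff_exists_add' _ _).2 ⟨d, add_right_comm _ _ _⟩

theorem ne_top_of_le {a b : T} (hb : b ≠ ⊤) (h : a ≤ b) : a ≠ ⊤ :=
  fun h' => hb (top_le_iff.1 (h' ▸ h))

theorem sum_mono {I : Type u} {f g : I → T} (h : ∀ i, f i ≤ g i) : sum f ≤ sum g := by
  choose d hd using fun i => exists_add_of_le (h i)
  rw [show g = fun i => f i + d i from funext hd, sum_add]
  exact le_self_add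

theorem le_sum {I : Type u} (f : I → T) (i : I) : f i ≤ sum f := by
  rw [sum_split (fun j => j = i) f, sum_unique]
  exact le_self_add

theorem sum_const_add_const {I : Type u} [Infinite I] (a : T) :
    (sum fun _ : I => a) + a = sum fun _ : I => a := by
  apply le_antisymm _ le_self_add
  conv_rhs => rw [← sum_const_add_self]
  gcongr
  exact le_sum (fun _ : I => a) (Classical.arbitrary I)

theorem add_sum_const_of_add_eq {I : Type u} [Finite I] {a x : T} (h : a + x = a) :
    a + sum (fun _ : I => x) = a := by
  induction I using Finite.induction_empty_option with
  | of_equiv e ih =>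
    rw [← ih]; congr 1
    exact (sum_congr_equiv e fun _ => rfl).symm
  | h_empty => rw [sum_empty, add_zero]
  | h_option ih => rw [sum_option, ← add_assoc, h, ih]

end DimensionMonoid

namespace DimensionMonoid

open SumMonoid

variable {T : Type u} [DimensionMonoid T]

/-! ### Orthogonality and bands -/

/-- The two elements have no nonzero common lower bound. -/
def Orth (a b : T) : Prop := ∀ x, x ≤ a → x ≤ b → x = 0

theorem Orth.symm {a b : T} (h : Orth a b) : Orth b a := fun x h1 h2 => h x h2 h1

theorem Orth.mono {a b a' b' : T} (h : Orth a b) (ha : a' ≤ a) (hb : b' ≤ b) : Orth a' b' :=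
  fun x h1 h2 => h x (h1.trans ha) (h2.trans hb)

theorem Orth.eq_zero {a : T} (h : Orth a a) : a = 0 := h a le_rfl le_rfl

/-- The band of all elements below the top which are orthogonal to `X`. -/
def oc (X : Set T) : Set T := {s | s ≠ ⊤ ∧ ∀ x ∈ X, Orth s x}

theorem oc_anti {X Y : Set T} (h : X ⊆ Y) : oc Y ⊆ oc X :=
  fun _ hs => ⟨hs.1, fun x hx => hs.2 x (h hx)⟩

theorem mem_oc_oc {X : Set T} {x : T} (hx : x ≠ ⊤) (h : x ∈ X) : x ∈ oc (oc X) :=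
  ⟨hx, fun _ hs => (hs.2 x h).symm⟩

theorem oc_oc_oc (X : Set T) : oc (oc (oc X)) = oc X :=
  Set.Subset.antisymm (fun s hs => ⟨hs.1, fun x hx y hy hyx => by
      -- The set `X` may contain `⊤`, which lies in no band. Then `oc X` has no nonzero element, so
      -- every element below the top belongs to `oc (oc X)`.
      by_cases hx' : x = ⊤
      · refine (hs.2 y ⟨ne_top_of_le hs.1 hy, fun z hz => ?_⟩) y hy le_rfl
        exact (hz.2 x hx).symm.mono hyx le_rfl
      · exact hs.2 x (mem_oc_oc hx' hx) y hy hyx⟩)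
    fun _ hs => mem_oc_oc hs.1 hs

theorem oc_union (X Y : Set T) : oc (X ∪ Y) = oc X ∩ oc Y :=
  Set.Subset.antisymm (Set.subset_inter (oc_anti Set.subset_union_left)
    (oc_anti Set.subset_union_right))
    fun _ hs => ⟨hs.1.1, fun x hx => hx.elim (hs.1.2 x) (hs.2.2 x)⟩

theorem oc_lower {X : Set T} {a b : T} (h : a ≤ b) (hb : b ∈ oc X) : a ∈ oc X :=
  ⟨ne_top_of_le hb.1 h, fun x hx => (hb.2 x hx).mono h le_rfl⟩

theorem zero_mem_oc {X : Set T} {a : T} (ha : a ≠ ⊤) : 0 ∈ oc X :=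
  ⟨ne_top_of_le ha zero_le, fun _ _ _ h _ => le_zero_iff.1 h⟩

theorem orth_of_mem_oc {X : Set T} {a b : T} (ha : a ∈ oc X) (hb : b ∈ oc (oc X)) : Orth a b :=
  (hb.2 a ha).symm

theorem eq_zero_of_mem_oc {X : Set T} {a : T} (ha : a ∈ oc X) (hb : a ∈ oc (oc X)) : a = 0 :=
  (orth_of_mem_oc ha hb).eq_zero

theorem sum_mem_oc {X : Set T} {I : Type u} {f : I → T} (hf : ∀ i, f i ∈ oc X)
    (h : sum f ≠ ⊤) : sum f ∈ oc X :=
  ⟨h, fun x hx z hz hzx => eq_zero_of_le_sum f z h hz fun i _ hy hyf =>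
    (hf i).2 x hx _ hyf (hy.trans hzx)⟩

theorem add_mem_oc {X : Set T} {a b : T} (ha : a ∈ oc X) (hb : b ∈ oc X) (h : a + b ≠ ⊤) :
    a + b ∈ oc X := by
  rw [← sum_bool] at h ⊢
  refine sum_mem_oc ?_ h
  rintro ⟨_ | _⟩
  exacts [hb, ha]

/-- Exhausting `x` by elements of `oc X` leaves a remainder without nonzero part in `oc X`, hence in
the complementary band; the exhausted part stays in `oc X` because bands are closed under sums. -/
theorem exists_oc_add (X : Set T) {x : T} (hx : x ≠ ⊤) :
    ∃ u v, x = u + v ∧ u ∈ oc X ∧ v ∈ oc (oc X) := by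
  obtain ⟨I, t, r, ht, hc, hr⟩ := exhaustion (fun _ : PUnit.{u + 1} => x) (fun _ => hx)
    (· ∈ oc X)
  have hc := hc ⟨⟩
  have hs : sum t ≠ ⊤ := ne_top_of_le hx (hc ▸ le_self_add)
  have hr' : r ⟨⟩ ≠ ⊤ := ne_top_of_le hx (hc ▸ le_add_self)
  exact ⟨_, _, hc, sum_mem_oc ht hs, hr', fun y hy z hz hzy =>
    hr z (oc_lower hzy hy) fun _ => hz⟩

open Classical in
/-- The component of `x` in the band `oc X`. -/
noncomputable def off (X : Set T) (x : T) : T :=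
  if hx : x ≠ ⊤ then (exists_oc_add X hx).choose else ⊤

theorem off_exists (X : Set T) {x : T} (hx : x ≠ ⊤) :
    ∃ v, x = off X x + v ∧ off X x ∈ oc X ∧ v ∈ oc (oc X) := by
  rw [off, dif_pos hx]
  exact (exists_oc_add X hx).choose_spec

theorem off_mem (X : Set T) {x : T} (hx : x ≠ ⊤) : off X x ∈ oc X :=
  let ⟨_, _, h, _⟩ := off_exists X hx; h

/-- In a common refinement of the two decompositions, the cross terms lie in both complementary
bands and vanish. -/
theorem component_unique {X : Set T} {u v u' v' : T} (h : u + v = u' + v') (hne : u + v ≠ ⊤)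
    (hu : u ∈ oc X) (hv : v ∈ oc (oc X)) (hu' : u' ∈ oc X) (hv' : v' ∈ oc (oc X)) : u = u' := by
  obtain ⟨c00, c01, c10, c11, h0, h1, h2, h3⟩ := refinement _ _ _ _ h hne
  have e1 : c01 = 0 := eq_zero_of_mem_oc (oc_lower (h0 ▸ le_add_self) hu)
    (oc_lower (h3 ▸ le_self_add) hv')
  have e2 : c10 = 0 := eq_zero_of_mem_oc (oc_lower (h2 ▸ le_add_self) hu')
    (oc_lower (h1 ▸ le_self_add) hv)
  rw [← h0, ← h2, e1, e2]

theorem off_eq {X : Set T} {x u v : T} (hx : x ≠ ⊤) (h : x = u + v) (hu : u ∈ oc X)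
    (hv : v ∈ oc (oc X)) : off X x = u := by
  obtain ⟨w, hw, h1, h2⟩ := off_exists X hx
  exact component_unique (hw.symm.trans h) (hw ▸ hx) h1 h2 hu hv

theorem off_add_off (X : Set T) {x : T} (hx : x ≠ ⊤) : off X x + off (oc X) x = x := by
  obtain ⟨w, hw, h1, h2⟩ := off_exists X hx
  have : off (oc X) x = w := off_eq hx (hw.trans (add_comm _ _)) h2 (by rwa [oc_oc_oc])
  rw [this, ← hw]

theorem off_le (X : Set T) (x : T) : off X x ≤ x := by
  by_cases hx : x = ⊤
  · rw [hx]; exact le_top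
  · obtain ⟨w, hw, -⟩ := off_exists X hx
    exact le_self_add.trans_eq hw.symm

theorem off_ne_top (X : Set T) {x : T} (hx : x ≠ ⊤) : off X x ≠ ⊤ := ne_top_of_le hx (off_le X x)

theorem off_add (X : Set T) {x y : T} (h : x + y ≠ ⊤) : off X (x + y) = off X x + off X y := by
  have hx := ne_top_of_le h (le_self_add : x ≤ x + y)
  have hy := ne_top_of_le h (le_add_self : y ≤ x + y)
  refine off_eq h (v := off (oc X) x + off (oc X) y) ?_ (add_mem_oc (off_mem X hx) (off_mem X hy) ?_)
    (add_mem_oc (off_mem _ hx) (off_mem _ hy) ?_)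
  · conv_lhs => rw [← off_add_off X hx, ← off_add_off X hy]
    exact add_add_add_comm _ _ _ _
  · exact ne_top_of_le h (add_le_add (off_le _ _) (off_le _ _))
  · exact ne_top_of_le h (add_le_add (off_le _ _) (off_le _ _))

theorem off_sum (X : Set T) {I : Type u} {f : I → T} (h : sum f ≠ ⊤) :
    off X (sum f) = sum fun i => off X (f i) := by
  have hf : ∀ i, f i ≠ ⊤ := fun i => ne_top_of_le h (le_sum f i)
  refine off_eq h (v := sum fun i => off (oc X) (f i)) ?_
    (sum_mem_oc (fun i => off_mem X (hf i)) ?_) (sum_mem_oc (fun i => off_mem _ (hf i)) ?_)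
  · rw [← sum_add]
    exact congrArg sum (funext fun i => (off_add_off X (hf i)).symm)
  · exact ne_top_of_le h (sum_mono fun i => off_le _ _)
  · exact ne_top_of_le h (sum_mono fun i => off_le _ _)

theorem off_mono (X : Set T) {x y : T} (hy : y ≠ ⊤) (h : x ≤ y) : off X x ≤ off X y := by
  obtain ⟨d, rfl⟩ := exists_add_of_le h
  rw [off_add X hy]
  exact le_self_add

theorem off_eq_self {X : Set T} {x : T} (h : x ∈ oc X) : off X x = x :=
  off_eq h.1 (add_zero _).symm h (zero_mem_oc h.1)

theorem off_eq_zero {X : Set T} {x : T} (h : x ∈ oc (oc X)) : off X x = 0 :=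
  off_eq h.1 (zero_add _).symm (zero_mem_oc h.1) h

theorem off_off_of_subset {X Y : Set T} (h : oc Y ⊆ oc X) {x : T} (hx : x ≠ ⊤) :
    off Y (off X x) = off Y x := by
  conv_rhs => rw [← off_add_off X hx, off_add Y ((off_add_off X hx).symm ▸ hx)]
  rw [off_eq_zero (x := off (oc X) x) (oc_anti h (off_mem _ hx)), add_zero]

theorem off_sup (X Y : Set T) {x : T} (hx : x ≠ ⊤) : off X (off Y x) = off (X ∪ Y) x := by
  have h := off_ne_top Y hx
  have h1 : off X (off Y x) ∈ oc (X ∪ Y) := by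
    rw [oc_union]
    exact ⟨off_mem X h, oc_lower (off_le _ _) (off_mem Y hx)⟩
  rw [← off_eq_self h1, off_off_of_subset (oc_anti Set.subset_union_left) h,
    off_off_of_subset (oc_anti Set.subset_union_right) hx]

theorem off_empty (x : T) : off ∅ x = x := by
  by_cases hx : x = ⊤
  · rw [hx, off, dif_neg (not_not.2 rfl)]
  · exact off_eq_self ⟨hx, fun _ h => h.elim⟩

theorem off_le_off_of_subset {X Y : Set T} (h : oc Y ⊆ oc X) {x y : T} (hx : x ≠ ⊤) (hy : y ≠ ⊤)
    (hle : off X x ≤ off X y) : off Y x ≤ off Y y := by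
  rw [← off_off_of_subset h hx, ← off_off_of_subset h hy]
  exact off_mono _ (off_ne_top _ hy) hle

/-- An element is the sum of its components in pairwise orthogonal bands which are jointly
dense. -/
theorem eq_sum_off {I : Type u} (X : I → Set T)
    (hX : ∀ i j, i ≠ j → ∀ a ∈ oc (X i), ∀ b ∈ oc (X j), Orth a b)
    (hd : ∀ e ≠ ⊤, (∀ i, ∀ a ∈ oc (X i), Orth e a) → e = 0) {x : T} (hx : x ≠ ⊤) :
    x = sum fun i => off (X i) x := by
  -- Exhaust `x` by elements lying in at least one of the bands. Density kills the remainder, and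
  -- grouping the terms by a chosen band gives the components.
  obtain ⟨J, t, r, ht, hc, hr⟩ := exhaustion (fun _ : PUnit.{u + 1} => x) (fun _ => hx)
    (fun y => ∃ i, y ∈ oc (X i))
  replace hc := hc ⟨⟩
  choose g hg using ht
  have hr0 : r ⟨⟩ = 0 := hd _ (ne_top_of_le hx (hc ▸ le_add_self)) fun i a ha y hy hya =>
    hr y ⟨i, oc_lower hya ha⟩ fun _ => hy
  rw [hr0, add_zero, sum_fiber g] at hc
  set v : I → T := fun i => sum fun j : {j // g j = i} => t j with hv
  have hvne : ∀ i, v i ≠ ⊤ := fun i => ne_top_of_le hx (hc ▸ le_sum v i)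
  have hvm : ∀ i, v i ∈ oc (X i) := fun i => sum_mem_oc (fun j => by
    have := hg j.1
    rwa [j.2] at this) (hvne i)
  have : (fun i => off (X i) x) = v := by
    funext i
    have hs := sum_split (fun j => j = i) v
    rw [sum_unique (I := {j // j = i})] at hs
    rw [hs] at hc
    refine off_eq hx hc (hvm i) (sum_mem_oc (fun j => ⟨hvne j.1, fun a ha => ?_⟩)
      (ne_top_of_le hx (hc ▸ le_add_self)))
    exact hX _ _ j.2 _ (hvm j.1) _ ha
  rw [this]
  exact hc

/-! ### Comparability -/

/-- Removing a maximal common part from `x` and `y` leaves orthogonal remainders. The set `X`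
consists of the remainder of `x`: the band `oc X` kills it, and the complementary band kills the
remainder of `y`. -/
theorem comparability {x y : T} (hx : x ≠ ⊤) (hy : y ≠ ⊤) :
    ∃ X : Set T, off X x ≤ off X y ∧ off (oc X) y ≤ off (oc X) x := by
  obtain ⟨I, t, r, -, hc, hr⟩ := exhaustion (fun b : ULift.{u} Bool => cond b.down x y)
    (by rintro ⟨_ | _⟩ <;> assumption) (fun _ => True)
  have h1 : x = sum t + r ⟨true⟩ := hc ⟨true⟩
  have h2 : y = sum t + r ⟨false⟩ := hc ⟨false⟩
  have hrx : r ⟨true⟩ ≠ ⊤ := ne_top_of_le hx (h1 ▸ le_add_self)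
  have hry : r ⟨false⟩ ≠ ⊤ := ne_top_of_le hy (h2 ▸ le_add_self)
  have hor : Orth (r ⟨true⟩) (r ⟨false⟩) := fun z hz1 hz2 => hr z trivial
    (by rintro ⟨_ | _⟩ <;> assumption)
  refine ⟨{r ⟨true⟩}, ?_, ?_⟩
  · have : off {r ⟨true⟩} (r ⟨true⟩) = 0 := off_eq_zero (mem_oc_oc hrx rfl)
    rw [h1, off_add _ (h1 ▸ hx), this, add_zero, h2, off_add _ (h2 ▸ hy)]
    exact le_self_add
  · have : off (oc {r ⟨true⟩}) (r ⟨false⟩) = 0 :=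
      off_eq_zero (mem_oc_oc hry ⟨hry, by rintro _ rfl; exact hor.symm⟩)
    rw [h2, off_add _ (h2 ▸ hy), this, add_zero, h1, off_add _ (h1 ▸ hx)]
    exact le_self_add

/-- The band `oc X` is nonzero. -/
def NZ (X : Set T) : Prop := ∃ e ∈ oc X, e ≠ 0

theorem off_eq_zero_of_not_NZ {X : Set T} (h : ¬ NZ X) {x : T} (hx : x ≠ ⊤) : off X x = 0 := by
  by_contra h'
  exact h ⟨_, off_mem X hx, h'⟩

theorem oc_oc_singleton_subset {X : Set T} {e : T} (h : e ∈ oc X) : oc (oc {e}) ⊆ oc X := by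
  rw [← oc_oc_oc X]
  exact oc_anti (oc_anti (Set.singleton_subset_iff.2 h))

/-- An inequality holds if it holds on a dense set of bands. -/
theorem le_of_dense {x y : T} (hx : x ≠ ⊤) (hy : y ≠ ⊤)
    (h : ∀ X : Set T, NZ X → ∃ Y, X ⊆ Y ∧ NZ Y ∧ off Y x ≤ off Y y) : x ≤ y := by
  -- The band generated by `e` is `oc (oc {e})`, so `off (oc {e})` projects onto it. A maximal
  -- orthogonal set of such `e` is dense by `h`, and the inequalities on the bands they generate are
  -- summed.
  let G : Set T := {e | e ≠ 0 ∧ e ≠ ⊤ ∧ off (oc {e}) x ≤ off (oc {e}) y}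
  obtain ⟨F, hF⟩ := zorn_subset {F : Set T | F ⊆ G ∧ F.Pairwise Orth} (by
    intro c hc hch
    refine ⟨⋃₀ c, ⟨Set.sUnion_subset fun s hs => (hc hs).1, ?_⟩, fun s hs =>
      Set.subset_sUnion_of_mem hs⟩
    exact (Set.pairwise_sUnion hch.directedOn).2 fun s hs => (hc hs).2)
  obtain ⟨⟨hFG, hFp⟩, hmax⟩ := hF
  have hdense : ¬ NZ F := by
    intro hNZ
    obtain ⟨Y, hFY, ⟨e, he, he0⟩, hle⟩ := h F hNZ
    have heG : e ∈ G := ⟨he0, he.1, off_le_off_of_subset (oc_oc_singleton_subset he) hx hy hle⟩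
    have heF : ∀ f ∈ F, Orth e f := fun f hf => he.2 f (hFY hf)
    have : e ∈ F := hmax (y := insert e F) ⟨Set.insert_subset heG hFG,
      hFp.insert fun f hf _ => ⟨heF f hf, (heF f hf).symm⟩⟩ (Set.subset_insert _ _)
      (Set.mem_insert _ _)
    exact he0 (heF e this).eq_zero
  have hX : ∀ i j : F, i ≠ j → ∀ a ∈ oc (oc {(i : T)}), ∀ b ∈ oc (oc {(j : T)}), Orth a b := by
    intro i j hij a ha b hb
    have hj : (j : T) ∈ oc {(i : T)} := ⟨(hFG j.2).2.1, by
      rintro _ rfl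
      exact hFp j.2 i.2 fun h => hij (Subtype.ext h.symm)⟩
    exact (orth_of_mem_oc (oc_oc_singleton_subset hj hb) ha).symm
  have hd : ∀ e ≠ (⊤ : T), (∀ i : F, ∀ a ∈ oc (oc {(i : T)}), Orth e a) → e = 0 := by
    intro e he hh
    by_contra h0
    exact hdense ⟨e, ⟨he, fun f hf => hh ⟨f, hf⟩ f (mem_oc_oc (hFG hf).2.1 rfl)⟩, h0⟩
  rw [eq_sum_off (fun i : F => oc {(i : T)}) hX hd hx, eq_sum_off (fun i : F => oc {(i : T)}) hX hd hy]
  exact sum_mono fun i => (hFG i.2).2.2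

theorem off_le_off_of_dense {x y : T} (hx : x ≠ ⊤) (hy : y ≠ ⊤) {X : Set T}
    (h : ∀ Y, X ⊆ Y → NZ Y → ∃ Z, Y ⊆ Z ∧ NZ Z ∧ off Z x ≤ off Z y) : off X x ≤ off X y := by
  refine le_of_dense (off_ne_top _ hx) (off_ne_top _ hy) fun Y hY => ?_
  by_cases hN : NZ (Y ∪ X)
  · obtain ⟨Z, hZ, hNZ, hle⟩ := h _ Set.subset_union_right hN
    refine ⟨Z, Set.subset_union_left.trans hZ, hNZ, ?_⟩
    rw [off_off_of_subset (oc_anti (Set.subset_union_right.trans hZ)) hx,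
      off_off_of_subset (oc_anti (Set.subset_union_right.trans hZ)) hy]
    exact hle
  · refine ⟨Y, subset_rfl, hY, ?_⟩
    rw [off_sup _ _ hx, off_eq_zero_of_not_NZ hN hx]
    exact zero_le

/-- By density, some nonzero band below `oc X` has no nonzero subband on which `x ≤ y`. It must then
be disjoint from the half where comparability gives `x ≤ y`, so it lies in the half where `y ≤ x`.
-/
theorem exists_nowhere_le {x y : T} (hx : x ≠ ⊤) (hy : y ≠ ⊤) {X : Set T}
    (h : ¬ off X x ≤ off X y) : ∃ Y, X ⊆ Y ∧ NZ Y ∧ off Y y ≤ off Y x ∧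
      ∀ Z, Y ⊆ Z → NZ Z → ¬ off Z x ≤ off Z y := by
  by_contra! hcon
  refine h (off_le_off_of_dense hx hy fun Y hXY hY => ?_)
  by_contra! hno
  obtain ⟨C, hC1, hC2⟩ := comparability hx hy
  have hCY : oc Y ⊆ oc (oc C) := by
    intro e he
    refine ⟨he.1, fun a ha z hz hza => ?_⟩
    by_contra h0
    refine hno (Y ∪ C) Set.subset_union_left ⟨z, ?_, h0⟩
      (off_le_off_of_subset (oc_anti Set.subset_union_right) hx hy hC1)
    rw [oc_union]
    exact ⟨oc_lower hz he, oc_lower hza ha⟩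
  obtain ⟨Z, hYZ, hZ, hle⟩ := hcon Y hXY hY (off_le_off_of_subset hCY hy hx hC2)
  exact hno Z hYZ hZ hle

theorem exists_nowhere_le' {x y : T} (hx : x ≠ ⊤) (hy : y ≠ ⊤)
    (h : ¬ x ≤ y) : ∃ Y : Set T, NZ Y ∧ off Y y ≤ off Y x ∧
      ∀ Z, Y ⊆ Z → NZ Z → ¬ off Z x ≤ off Z y := by
  obtain ⟨Y, -, hY⟩ := exists_nowhere_le (X := ∅) hx hy (by rwa [off_empty, off_empty])
  exact ⟨Y, hY⟩

/-- The largest band is the one generated by all `e` whose generated band satisfies the inequality;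
these bands are dense in it. -/
theorem exists_largest_band {x y : T} (hx : x ≠ ⊤) (hy : y ≠ ⊤) :
    ∃ X : Set T, off X x ≤ off X y ∧ ∀ Y : Set T, off Y x ≤ off Y y → oc Y ⊆ oc X := by
  let G : Set T := {e | e ≠ ⊤ ∧ off (oc {e}) x ≤ off (oc {e}) y}
  refine ⟨oc G, off_le_off_of_dense hx hy fun Y hGY hY => ?_, fun Y hle e he =>
    mem_oc_oc he.1 ⟨he.1, off_le_off_of_subset (oc_oc_singleton_subset he) hx hy hle⟩⟩
  obtain ⟨e, he, he0⟩ := hY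
  have heG : ¬ e ∈ oc G := fun h => he0 (eq_zero_of_mem_oc h (oc_anti hGY he))
  have : ∃ g ∈ G, ¬ Orth e g := by
    by_contra! hh
    exact heG ⟨he.1, hh⟩
  obtain ⟨g, hg, hh⟩ := this
  simp only [Orth, not_forall] at hh
  obtain ⟨z, hze, hzg, hz0⟩ := hh
  have hzt := ne_top_of_le he.1 hze
  refine ⟨Y ∪ oc {z}, Set.subset_union_left, ⟨z, ?_, hz0⟩, ?_⟩
  · rw [oc_union]
    exact ⟨oc_lower hze he, mem_oc_oc hzt rfl⟩
  · refine off_le_off_of_subset (Y := Y ∪ oc {z}) ?_ hx hy hg.2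
    rw [oc_union]
    exact Set.inter_subset_right.trans
      (oc_oc_singleton_subset (oc_lower hzg (mem_oc_oc hg.1 rfl)))

end DimensionMonoid

namespace DimensionMonoid

open SumMonoid

variable {T : Type u} [DimensionMonoid T]

/-! ### Finite and purely infinite elements -/

/-- The element is directly finite. -/
def DFin (c : T) : Prop := ∀ x, x + c = c → x = 0

/-- The element is purely infinite. -/
def PInf (a : T) : Prop := a + a = a

theorem PInf.map_off {a : T} (h : PInf a) (ha : a ≠ ⊤) (X : Set T) : PInf (off X a) := by
  rw [PInf, ← off_add X (h.symm ▸ ha), h]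

theorem DFin.of_add {a b : T} (h : DFin (a + b)) : DFin a := fun x hx =>
  h x (by rw [← add_assoc, hx])

theorem DFin.of_le {a b : T} (h : DFin b) (hab : a ≤ b) : DFin a := by
  obtain ⟨d, rfl⟩ := exists_add_of_le hab
  exact h.of_add

theorem DFin.eq_zero {a : T} (h : DFin a) (h' : PInf a) : a = 0 := h a h'

theorem DFin.zero : DFin (0 : T) := fun x hx => by rwa [add_zero] at hx

theorem PInf.le_of_add_le {a b c : T} (h : PInf b) (ha : a ≤ b) (hc : c ≤ b) : a + c ≤ b :=
  (add_le_add ha hc).trans_eq h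

/-- Exhaust `a` by copies of `x` and pass to a band where the remainder is below `x`. If there are
finitely many copies, `a` absorbs them, and also the remainder, so `a + a = a`; if infinitely many,
they absorb the remainder and are unchanged by doubling. -/
theorem exists_pInf_of_add_eq {a x : T} (ha : a ≠ ⊤) (h : a + x = a) (hx : x ≠ 0) :
    ∃ Z : Set T, off Z x ≠ 0 ∧ PInf (off Z a) := by
  have hxt : x ≠ ⊤ := ne_top_of_le ha (h ▸ le_add_self)
  obtain ⟨I, t, r, ht, hc, hr⟩ := exhaustion (fun _ : PUnit.{u + 1} => a) (fun _ => ha) (· = x)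
  replace hc := hc ⟨⟩
  obtain rfl : t = fun _ => x := funext ht
  have hxr : ¬ x ≤ r ⟨⟩ := fun hle => hx (hr x rfl fun _ => hle)
  have hrt : r ⟨⟩ ≠ ⊤ := ne_top_of_le ha (hc ▸ le_add_self)
  have hst : sum (fun _ : I => x) ≠ ⊤ := ne_top_of_le ha (hc ▸ le_self_add)
  obtain ⟨Y, hY, hle, hno⟩ := exists_nowhere_le' hxt hrt hxr
  refine ⟨Y, fun h0 => hno Y subset_rfl hY (h0 ▸ zero_le), ?_⟩
  have hc' : off Y a = sum (fun _ : I => off Y x) + off Y (r ⟨⟩) := by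
    rw [← off_sum Y hst, ← off_add Y (hc ▸ ha), ← hc]
  have h' : off Y a + off Y x = off Y a := by rw [← off_add Y (h.symm ▸ ha), h]
  cases finite_or_infinite I
  · have hfin := add_sum_const_of_add_eq (I := I) h'
    refine le_antisymm ?_ le_self_add
    conv_lhs => rw [hc']
    calc sum (fun _ : I => off Y x) + off Y (r ⟨⟩) + (sum (fun _ : I => off Y x) + off Y (r ⟨⟩))
        = off Y a + (sum (fun _ : I => off Y x) + off Y (r ⟨⟩)) := by rw [← hc']
      _ ≤ off Y a + (sum (fun _ : I => off Y x) + off Y x) := by gcongr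
      _ = off Y a := by rw [← add_assoc, hfin, h']
  · have : off Y a = sum (fun _ : I => off Y x) := le_antisymm
      ((hc'.trans_le (add_le_add_right hle _)).trans_eq (sum_const_add_const _))
      (hc' ▸ le_self_add)
    rw [this]
    exact sum_const_add_self _

/-- Exhaust `a` by purely infinite elements. If the remainder absorbed a nonzero element,
`exists_pInf_of_add_eq` would give a nonzero purely infinite part of it. -/
theorem exists_dFin_add_pInf {a : T} (ha : a ≠ ⊤) : ∃ x y, x + y = a ∧ DFin x ∧ PInf y := by
  obtain ⟨I, t, r, ht, hc, hr⟩ := exhaustion (fun _ : PUnit.{u + 1} => a) (fun _ => ha) PInf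
  replace hc := hc ⟨⟩
  refine ⟨r ⟨⟩, sum t, by rw [add_comm, ← hc], fun x hx => ?_, ?_⟩
  · by_contra h0
    have hrt : r ⟨⟩ ≠ ⊤ := ne_top_of_le ha (hc ▸ le_add_self)
    obtain ⟨Z, hZ, hp⟩ := exists_pInf_of_add_eq hrt (by rwa [add_comm]) h0
    have h1 := hr _ hp fun _ => off_le _ _
    exact hZ (le_zero_iff.1 ((off_mono Z hrt (hx ▸ le_self_add)).trans_eq h1))
  · rw [PInf, ← sum_add]
    exact congrArg sum (funext ht)

theorem exists_dFin_or_pInf {m : T} (hm : m ≠ ⊤) {X : Set T} (hX : NZ X) :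
    ∃ Y, X ⊆ Y ∧ NZ Y ∧ (DFin (off Y m) ∨ PInf (off Y m)) := by
  obtain ⟨f, w, rfl, hf, hw⟩ := exists_dFin_add_pInf hm
  have hft : f ≠ ⊤ := ne_top_of_le hm le_self_add
  have hwt : w ≠ ⊤ := ne_top_of_le hm le_add_self
  by_cases h : off X f ≤ off X w
  · refine ⟨X, subset_rfl, hX, Or.inr ?_⟩
    have hw' := hw.map_off hwt X
    rw [off_add X hm, show off X f + off X w = off X w from
      le_antisymm (hw'.le_of_add_le h le_rfl) le_add_self]
    exact hw'
  · obtain ⟨Y, hXY, hY, hle, -⟩ := exists_nowhere_le hft hwt h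
    refine ⟨Y, hXY, hY, Or.inl ?_⟩
    have hf' : DFin (off Y f) := hf.of_le (off_le _ _)
    rw [off_add Y hm, (hf'.of_le hle).eq_zero (hw.map_off hwt Y), add_zero]
    exact hf'

/-- Refine `s + s = a + b` and compare the diagonal terms locally. Where `c00 ≤ c11`, one copy of
`s` fits under `b`; where `c11 ≤ c00`, the other fits under `a`, so there `s` is both finite and
purely infinite, hence zero. -/
theorem PInf.le_of_eq_dFin_add {s a b : T} (hs : s ≠ ⊤) (h : PInf s) (hab : s = a + b)
    (ha : DFin a) : s ≤ b := by
  have hat : a ≠ ⊤ := ne_top_of_le hs (hab ▸ le_self_add)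
  have hbt : b ≠ ⊤ := ne_top_of_le hs (hab ▸ le_add_self)
  obtain ⟨c00, c01, c10, c11, h0, h1, h2, h3⟩ :=
    refinement s s a b (h.trans hab) (h.symm ▸ hs)
  have h00 : c00 ≠ ⊤ := ne_top_of_le hat (h2 ▸ le_self_add)
  have h11 : c11 ≠ ⊤ := ne_top_of_le hbt (h3 ▸ le_add_self)
  by_contra hle
  obtain ⟨Z, hZ, -, hno⟩ := exists_nowhere_le' hs hbt hle
  have hc : ¬ off Z c00 ≤ off Z c11 := by
    intro hc
    refine hno Z subset_rfl hZ ?_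
    rw [← h0, off_add Z (h0 ▸ hs), ← h3, off_add Z (h3 ▸ hbt), add_comm]
    gcongr
  obtain ⟨W, hZW, hW, hle', -⟩ := exists_nowhere_le h00 h11 hc
  refine hno W hZW hW ?_
  have hsa : off W s ≤ off W a := by
    rw [← h1, off_add W (h1 ▸ hs), ← h2, off_add W (h2 ▸ hat), add_comm]
    gcongr
  rw [((ha.of_le (off_le W a)).of_le hsa).eq_zero (h.map_off hs W)]
  exact zero_le

/-- If `u ≤ v` fails, then on some band `u = v + w` with `w ≠ 0`, and `m + v` absorbs `w`. On a
smaller band `m + v` is purely infinite, so `PInf.le_of_eq_dFin_add` discards `m` and gives `u ≤ m +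
v ≤ v` there. -/
theorem DFin.le_of_add_eq_add {m u v : T} (hm : DFin m) (h : m + u = m + v) (ht : m + u ≠ ⊤) :
    u ≤ v := by
  have hmt : m ≠ ⊤ := ne_top_of_le ht le_self_add
  have hut : u ≠ ⊤ := ne_top_of_le ht le_add_self
  have hvt : v ≠ ⊤ := ne_top_of_le ht (h ▸ le_add_self)
  by_contra hle
  obtain ⟨Z, hZ, hvu, hno⟩ := exists_nowhere_le' hut hvt hle
  obtain ⟨w, hw⟩ := exists_add_of_le hvu
  have hw0 : w ≠ 0 := fun h0 => hno Z subset_rfl hZ (by rw [hw, h0, add_zero])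
  have hst : off Z (m + v) ≠ ⊤ := off_ne_top Z (h ▸ ht)
  have hs : off Z (m + v) + w = off Z (m + v) := by
    conv_rhs => rw [← h, off_add Z ht, hw, ← add_assoc, ← off_add Z (h ▸ ht)]
  obtain ⟨W, hW0, hWp⟩ := exists_pInf_of_add_eq hst hs hw0
  have hwt : w ≠ ⊤ := ne_top_of_le (off_ne_top Z hut) (hw ▸ le_add_self)
  have hWZ : NZ (W ∪ Z) := by
    refine ⟨_, ?_, hW0⟩
    rw [oc_union]
    exact ⟨off_mem W hwt, oc_lower ((off_le W w).trans (hw ▸ le_add_self)) (off_mem Z hut)⟩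
  refine hno _ Set.subset_union_right hWZ ?_
  rw [off_sup W Z (h ▸ ht)] at hWp
  calc off (W ∪ Z) u ≤ off (W ∪ Z) (m + v) := off_mono _ (h ▸ ht) (h ▸ le_add_self)
    _ ≤ off (W ∪ Z) v := hWp.le_of_eq_dFin_add (off_ne_top _ (h ▸ ht))
      (off_add _ (h ▸ ht)) (hm.of_le (off_le _ _))

/-! ### Infima -/

theorem exists_isGLB {X : Set T} (hX : X.Nonempty) (hXt : ∀ x ∈ X, x ≠ ⊤) : ∃ m, IsGLB X m := by
  have : Nonempty X := hX.to_subtype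
  -- The infimum is the maximal part common to all elements of `X`. If a lower bound `n` is not
  -- below it, localize to a band where `n = m + d` and `m` is directly finite or purely infinite.
  obtain ⟨I, t, r, -, hc, hr⟩ := exhaustion (fun x : X => (x : T)) (fun x => hXt x x.2)
    (fun _ => True)
  refine ⟨sum t, fun x hx => le_self_add.trans_eq (hc ⟨x, hx⟩).symm, fun n hn => ?_⟩
  set m := sum t
  obtain ⟨x₀, hx₀⟩ := hX
  have hmt : m ≠ ⊤ := ne_top_of_le (hXt x₀ hx₀) (le_self_add.trans_eq (hc ⟨x₀, hx₀⟩).symm)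
  have hnt : n ≠ ⊤ := ne_top_of_le (hXt x₀ hx₀) (hn hx₀)
  have hrt : ∀ x : X, r x ≠ ⊤ := fun x => ne_top_of_le (hXt x x.2) (hc x ▸ le_add_self)
  have hoff : ∀ (W : Set T) (x : X), off W (x : T) = off W m + off W (r x) := fun W x => by
    rw [← off_add W (hc x ▸ hXt x x.2), ← hc x]
  by_contra hle
  obtain ⟨Z, hZ, hmn, hno⟩ := exists_nowhere_le' hnt hmt hle
  obtain ⟨Y, hZY, hY, hd⟩ := exists_dFin_or_pInf hmt hZ
  obtain ⟨d, hd'⟩ := exists_add_of_le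
    (off_le_off_of_subset (oc_anti hZY) hmt hnt hmn)
  have hfin : DFin (off Y m) := by
    rcases hd with hd | hd
    · exact hd
    -- In the purely infinite case the component of `m` is zero. Otherwise it is not below some `r
    -- x`, so on a subband `m` absorbs `r x`; there `n ≤ x ≤ m`, which was excluded.
    · rw [hr (off Y m) trivial fun x => ?_]
      · exact DFin.zero
      · refine le_trans ?_ (off_le Y (r x))
        by_contra hmr
        obtain ⟨W, hYW, hW, hle', -⟩ := exists_nowhere_le hmt (hrt x) hmr
        refine hno W (hZY.trans hYW) hW ((off_mono W (hXt x x.2) (hn x.2)).trans ?_)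
        rw [hoff]
        have : PInf (off W m) := by
          rw [← off_off_of_subset (oc_anti hYW) hmt]
          exact hd.map_off (off_ne_top _ hmt) W
        exact this.le_of_add_le le_rfl hle'
  -- Cancelling the finite `m` in `m + d ≤ m + r x` puts `d` below every remainder.
  have hd0 : d = 0 := hr d trivial fun x => by
    obtain ⟨e, he⟩ := exists_add_of_le (off_mono Y (hXt x x.2) (hn x.2))
    rw [hd', add_assoc, hoff] at he
    have := hfin.le_of_add_eq_add he.symm
      (he ▸ hoff Y x ▸ off_ne_top Y (hXt x x.2))
    exact (le_self_add.trans this).trans (off_le _ _)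
  exact hno Y hZY hY (by rw [hd', hd0, add_zero])

/-! ### Local minima and removable elements -/

/-- Among purely infinite elements, minima are locally attained. -/
theorem exists_local_min {X : Set T} (hX : X.Nonempty) (hXt : ∀ x ∈ X, x ≠ ⊤)
    (hXp : ∀ x ∈ X, PInf x) {B : Set T} (hB : NZ B) :
    ∃ D, B ⊆ D ∧ NZ D ∧ ∃ x₀ ∈ X, ∀ x ∈ X, off D x₀ ≤ off D x := by
  by_contra! hcon
  -- If no minimum is attained locally, every `x` in `X` is, on some band, an infinite multiple of
  -- another `y` in `X` and nowhere below it: exhaust `x` by copies of `y` until the remainder is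
  -- below `y`. Finitely many copies would be absorbed by the purely infinite `y`.
  have step : ∀ D, B ⊆ D → NZ D → ∀ x ∈ X, ∃ E, D ⊆ E ∧ NZ E ∧ ∃ y ∈ X, ∃ I : Type u, Infinite I ∧
      off E x = sum (fun _ : I => off E y) ∧ ∀ F, E ⊆ F → NZ F → ¬ off F x ≤ off F y := by
    intro D hBD hD x hx
    obtain ⟨y, hy, hxy⟩ := hcon D hBD hD x hx
    have hxt := hXt x hx
    have hyt := hXt y hy
    obtain ⟨D1, hDD1, hD1, hle, hno⟩ := exists_nowhere_le hxt hyt hxy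
    obtain ⟨I, t, r, ht, hc, hr⟩ := exhaustion (fun _ : PUnit.{u + 1} => off D1 x)
      (fun _ => off_ne_top _ hxt) (· = off D1 y)
    replace hc := hc ⟨⟩
    obtain rfl : t = fun _ => off D1 y := funext ht
    have hrt : r ⟨⟩ ≠ ⊤ := ne_top_of_le (off_ne_top D1 hxt) (hc ▸ le_add_self)
    have hst : sum (fun _ : I => off D1 y) ≠ ⊤ :=
      ne_top_of_le (off_ne_top D1 hxt) (hc ▸ le_self_add)
    have hyr : ¬ off D1 y ≤ r ⟨⟩ := fun h => by
      have h0 := hr _ rfl fun _ => h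
      obtain ⟨z, -, hz⟩ := hcon D1 (hBD.trans hDD1) hD1 y hy
      exact hz (h0 ▸ zero_le)
    have hyr' : ¬ off D1 y ≤ off D1 (r ⟨⟩) := fun h => hyr (h.trans (off_le _ _))
    obtain ⟨E, hDE, hE, hle', -⟩ := exists_nowhere_le hyt hrt hyr'
    have hoff : ∀ z ≠ (⊤ : T), off E (off D1 z) = off E z := fun z hz =>
      off_off_of_subset (oc_anti hDE) hz
    have hEc : off E x = sum (fun _ : I => off E y) + off E (r ⟨⟩) := by
      rw [← hoff x hxt, hc, off_add E (hc ▸ off_ne_top D1 hxt), off_sum E hst, hoff y hyt]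
    have hEle : off E x ≤ sum (fun _ : I => off E y) + off E y := by
      rw [hEc]
      gcongr
    have hyE := (hXp y hy).map_off hyt E
    have hI : Infinite I := by
      by_contra hfin
      have : Finite I := not_infinite_iff_finite.1 hfin
      refine hno E hDE hE (hEle.trans_eq ?_)
      rw [add_comm, add_sum_const_of_add_eq hyE]
    refine ⟨E, hDD1.trans hDE, hE, y, hy, I, hI, le_antisymm ?_ (hEc ▸ le_self_add),
      fun F hF => hno F (hDE.trans hF)⟩
    exact hEle.trans_eq (sum_const_add_const _)
  -- Take the least number `I` of copies that occurs, and apply `step` again to `y`, obtaining `J`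
  -- copies of `z`. As `I` is at most `J`, the `I × J` copies of `z` that make up `x` amount to `J`
  -- copies, so `x = y` on a band, a contradiction.
  let C : Set Cardinal.{u} := {κ | ∃ E, B ⊆ E ∧ NZ E ∧ ∃ x ∈ X, ∃ y ∈ X, ∃ I : Type u, Infinite I ∧
    Cardinal.mk I = κ ∧ off E x = sum (fun _ : I => off E y) ∧
      ∀ F, E ⊆ F → NZ F → ¬ off F x ≤ off F y}
  have hC : C.Nonempty := by
    obtain ⟨x, hx⟩ := hX
    obtain ⟨E, hE, hNE, y, hy, I, hI, h⟩ := step B subset_rfl hB x hx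
    exact ⟨_, E, hE, hNE, x, hx, y, hy, I, hI, rfl, h⟩
  obtain ⟨E, hE, hNE, x, hx, y, hy, I, hI, hIc, hsum, hno⟩ :=
    WellFounded.min_mem Cardinal.lt_wf C hC
  obtain ⟨F, hEF, hNF, z, hz, J, hJ, hsum', hno'⟩ := step E hE hNE y hy
  have hcard : Cardinal.mk I ≤ Cardinal.mk J := by
    rw [hIc]
    exact not_lt.1 (WellFounded.not_lt_min Cardinal.lt_wf C
      ⟨F, hE.trans hEF, hNF, y, hy, z, hz, J, hJ, rfl, hsum', hno'⟩)
  have e : Nonempty (I × J ≃ J) := by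
    rw [← Cardinal.eq]
    simpa using Cardinal.mul_eq_right (Cardinal.aleph0_le_mk J) hcard
      (Cardinal.mk_ne_zero I)
  refine hno F hEF hNF (le_of_eq ?_)
  rw [← off_off_of_subset (oc_anti hEF) (hXt x hx), hsum, off_sum F (hsum ▸ off_ne_top E (hXt x hx)),
    off_off_of_subset (oc_anti hEF) (hXt y hy), hsum', sum_const_prod]
  exact sum_congr_equiv e.some fun _ => rfl

/-- The first element is removable from the second. -/
def Rem (a b : T) : Prop := a ≤ b ∧ ∀ x, a + x ≠ ⊤ → b ≤ a + x → b ≤ x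

/-- The infimum `m` of the candidates is itself a candidate: by `exists_local_min` it agrees with
some candidate on a dense set of bands, and the required properties can be checked there. -/
theorem exists_least {a b : T} (hbt : b ≠ ⊤) (hb : PInf b) (hab : Rem a b) :
    ∃ m, (m ≠ ⊤ ∧ PInf m ∧ Rem a m ∧ oc {m} = oc {b}) ∧
      ∀ x, x ≠ ⊤ → PInf x → Rem a x → oc {x} = oc {b} → m ≤ x := by
  let X : Set T := {x | x ≠ ⊤ ∧ PInf x ∧ Rem a x ∧ oc {x} = oc {b}}
  have hbX : b ∈ X := ⟨hbt, hb, hab, rfl⟩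
  have hXt : ∀ x ∈ X, x ≠ ⊤ := fun x hx => hx.1
  obtain ⟨m, hlb, hgl⟩ := exists_isGLB ⟨b, hbX⟩ hXt
  have hmb : m ≤ b := hlb hbX
  have hmt : m ≠ ⊤ := ne_top_of_le hbt hmb
  have hloc : ∀ B : Set T, NZ B → ∃ D, B ⊆ D ∧ NZ D ∧ ∃ x ∈ X, off D m = off D x := by
    intro B hB
    obtain ⟨D, hBD, hD, x, hx, hmin⟩ := exists_local_min ⟨b, hbX⟩ hXt (fun x hx => hx.2.1) hB
    refine ⟨D, hBD, hD, x, hx, le_antisymm (off_mono D hx.1 (hlb hx)) ?_⟩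
    have : off D x ≤ m := hgl fun y hy => (hmin y hy).trans (off_le _ _)
    have := off_mono D hmt this
    rwa [off_eq_self (off_mem D hx.1)] at this
  refine ⟨m, ⟨hmt, ?_, ⟨hgl fun x hx => hx.2.2.1.1, fun y hay hle => ?_⟩, ?_⟩, fun x h1 h2 h3 h4 =>
    hlb ⟨h1, h2, h3, h4⟩⟩
  · exact le_antisymm (hgl fun x hx => hx.2.1.le_of_add_le (hlb hx) (hlb hx)) le_self_add
  · obtain ⟨d, hd⟩ := exists_add_of_le hle
    obtain ⟨c00, c01, c10, c11, h0, h1, h2, h3⟩ := refinement _ _ _ _ hd hay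
    have hc : m = c00 + c10 := h2.symm
    have h10 : c10 ≤ m := hc ▸ le_add_self
    have h10t : c10 ≠ ⊤ := ne_top_of_le hmt h10
    refine le_trans (le_of_dense hmt h10t fun B hB => ?_) (h1 ▸ le_self_add : c10 ≤ y)
    obtain ⟨D, hBD, hD, x, hx, hmx⟩ := hloc B hB
    refine ⟨D, hBD, hD, ?_⟩
    have hax := hx.2.2.1.1
    have hxt := hx.1
    have hz : c10 + off (oc D) x ≤ x := hx.2.1.le_of_add_le (h10.trans (hlb hx)) (off_le _ _)
    -- Outside the band `D` the elements `m` and `x` may differ, so the component of `x` there is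
    -- kept as a summand. Removability of `a` from `x` then applies, and projecting to `D` gives `m
    -- ≤ c10`.
    have key : x ≤ c10 + off (oc D) x := by
      refine hx.2.2.1.2 _ (ne_top_of_le hxt (hx.2.1.le_of_add_le hax hz)) ?_
      conv_lhs => rw [← off_add_off D hxt]
      rw [← hmx, ← add_assoc]
      gcongr
      refine (off_le D m).trans (hc.trans_le ?_)
      gcongr
      exact h0 ▸ le_self_add
    have := off_mono D (ne_top_of_le hxt hz) key
    rwa [off_add D (ne_top_of_le hxt hz), off_eq_zero (off_mem (oc D) hxt), add_zero,
      ← hmx] at this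
  · refine Set.Subset.antisymm (fun z hz => ⟨hz.1, ?_⟩)
      fun z hz => ⟨hz.1, by rintro _ rfl; exact (hz.2 b rfl).mono le_rfl hmb⟩
    rintro _ rfl u huz hub
    -- Inside the band generated by `u`, some band `D` has `m = x` with `x` a candidate. A nonzero
    -- part `v` of `u` in `D` is orthogonal to `m`, hence to `x`, hence to `b`, although `v ≤ b`.
    by_contra hu0
    have hu : u ∈ oc {m} := oc_lower huz hz
    obtain ⟨D, hBD, ⟨e, he, he0⟩, x, hx, hmx⟩ := hloc (oc {u}) ⟨u, mem_oc_oc hu.1 rfl, hu0⟩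
    have hut := hu.1
    have hou : ¬ Orth e u := fun h => he0 (eq_zero_of_mem_oc (X := {u})
      ⟨he.1, by rintro _ rfl; exact h⟩ (oc_anti hBD he))
    simp only [Orth, not_forall] at hou
    obtain ⟨v, hve, hvu, hv0⟩ := hou
    have hvD : v ∈ oc D := oc_lower hve he
    have hvx : v ∈ oc {x} := ⟨hvD.1, by
      rintro _ rfl w hwv hwx
      have h1 : w ≤ m := by
        rw [← off_eq_self (oc_lower hwv hvD)]
        exact (off_mono D hx.1 hwx).trans (hmx ▸ off_le D m)
      exact (oc_lower (hwv.trans hvu) hu).2 m rfl w le_rfl h1⟩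
    rw [hx.2.2.2] at hvx
    exact hv0 (hvx.2 _ rfl v le_rfl (hvu.trans hub))

end DimensionMonoid

namespace IsEspalier

variable {L : Type u} [PartialOrder L] {perp : L → L → Prop} {sim : Setoid L}

/-! ### Suprema and binary sums in an espalier -/

theorem exists_isBot (hL : IsEspalier perp sim) : ∃ z : L, IsBot z := by
  obtain ⟨x⟩ := hL.nonempty
  obtain ⟨m, hm⟩ := hL.exists_inf Set.univ ⟨x, trivial⟩
  exact ⟨m, fun y => hm.1 trivial⟩

theorem exists_isLUB (hL : IsEspalier perp sim) {X : Set L} (hX : BddAbove X) :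
    ∃ s, IsLUB X s := by
  obtain ⟨m, hm⟩ := hL.exists_inf (upperBounds X) hX
  exact ⟨m, isGLB_upperBounds.1 hm⟩

theorem isBot_of_perp (hL : IsEspalier perp sim) {a b x : L} (h : perp a b) (ha : x ≤ a)
    (hb : x ≤ b) : IsBot x :=
  hL.eq_zero_of_perp_self x (hL.perp_of_le _ _ _ ha
    (hL.perp_symm _ _ (hL.perp_of_le _ _ _ hb (hL.perp_symm _ _ h))))

theorem perp_mono (hL : IsEspalier perp sim) {a b a' b' : L} (h : perp a b) (ha : a' ≤ a)
    (hb : b' ≤ b) : perp a' b' :=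
  hL.perp_of_le _ _ _ ha (hL.perp_symm _ _ (hL.perp_of_le _ _ _ hb (hL.perp_symm _ _ h)))

theorem isLUB_pair_iff {X Y : Set L} {b d c : L} (hb : IsLUB X b) (hd : IsLUB Y d) :
    IsLUB {b, d} c ↔ IsLUB (X ∪ Y) c := by
  have : upperBounds {b, d} = upperBounds (X ∪ Y) := by
    rw [upperBounds_union, hb.upperBounds_eq, hd.upperBounds_eq, upperBounds_insert,
      upperBounds_singleton]
  rw [IsLUB, IsLUB, this]

theorem isLUB_insert_iff {X : Set L} {b d c : L} (hb : IsLUB X b) :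
    IsLUB {b, d} c ↔ IsLUB (insert d X) c := by
  rw [isLUB_pair_iff hb isLUB_singleton, Set.union_singleton]

theorem oplus_symm (hL : IsEspalier perp sim) {a b c : L} (h : IsOplus perp a b c) :
    IsOplus perp b a c :=
  ⟨hL.perp_symm _ _ h.1, by rw [Set.pair_comm]; exact h.2⟩

theorem _root_.IsOplus.le_left {a b c : L} (h : IsOplus perp a b c) : a ≤ c :=
  h.2.1 (Set.mem_insert _ _)

theorem _root_.IsOplus.le_right {a b c : L} (h : IsOplus perp a b c) : b ≤ c :=
  h.2.1 (Set.mem_insert_of_mem _ rfl)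

theorem oplus_assoc (hL : IsEspalier perp sim) {a b c d x : L} (h1 : IsOplus perp a b x)
    (h2 : IsOplus perp x c d) : ∃ y, IsOplus perp b c y ∧ IsOplus perp a y d := by
  have hbd : b ≤ d := h1.le_right.trans h2.le_left
  obtain ⟨y, hy⟩ := hL.exists_isLUB (X := {b, c}) ⟨d, by
    rintro _ (rfl | rfl)
    exacts [hbd, h2.le_right]⟩
  refine ⟨y, ⟨hL.perp_of_le _ _ _ h1.le_right h2.1, hy⟩, hL.perp_assoc a b c x y ⟨d, ?_⟩ h1.1 h1.2
    hy h2.1, ?_⟩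
  · rintro _ (rfl | rfl | rfl)
    exacts [h1.le_left.trans h2.le_left, hbd, h2.le_right]
  · have := (isLUB_pair_iff h1.2 isLUB_singleton).1 h2.2
    rw [isLUB_pair_iff isLUB_singleton hy]
    convert this using 1
    ext; simp; tauto

theorem oplus_assoc' (hL : IsEspalier perp sim) {a b c d y : L} (h1 : IsOplus perp b c y)
    (h2 : IsOplus perp a y d) : ∃ x, IsOplus perp a b x ∧ IsOplus perp x c d := by
  obtain ⟨x, hx, hx'⟩ := hL.oplus_assoc (hL.oplus_symm h1) (hL.oplus_symm h2)
  exact ⟨x, hL.oplus_symm hx, hL.oplus_symm hx'⟩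

theorem oplus_bot (hL : IsEspalier perp sim) {z : L} (hz : IsBot z) (a : L) :
    IsOplus perp a z a :=
  ⟨hL.perp_zero a z hz, by
    rw [Set.pair_comm, IsLUB, upperBounds_insert, upperBounds_singleton,
      Set.inter_eq_right.2 (Set.Ici_subset_Ici.2 (hz a))]
    exact isLeast_Ici⟩

/-- This is the parallelogram rule for `x` and `a`, whose meet is `0`. -/
theorem sim_of_oplus (hL : IsEspalier perp sim) {a x y c : L} (hx : IsOplus perp a x c)
    (hy : IsOplus perp a y c) : sim x y := by
  obtain ⟨z, hz⟩ := hL.exists_isBot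
  refine hL.parallelogram x a x y z c ⟨fun _ _ => hz _, fun w hw => ?_⟩
    (hL.oplus_symm hx).2 (hL.oplus_symm (hL.oplus_bot hz x)) hy
  exact hL.isBot_of_perp hx.1 (hw (Set.mem_insert_of_mem _ rfl)) (hw (Set.mem_insert _ _)) _

/-! ### Orthogonal families -/

section Families

variable {I : Type u} {a : I → L}

theorem _root_.IsFinOplus.isLUB {J : Finset I} {c : L} (h : IsFinOplus perp a J c) :
    IsLUB (a '' J) c := by
  induction h with
  | empty hz => simpa using hz
  | cons hj _ hc ih =>
    rw [Finset.coe_cons, Set.image_insert_eq]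
    exact (isLUB_insert_iff ih).1 hc.2

/-- Frees finite sums from the order of summation: with `isFamOplus_of_perp`, orthogonality of a
family becomes a symmetric condition on suprema. If the last index lies in `K`, `perp_assoc` moves
its term to the other side. -/
theorem perp_of_isFinOplus (hL : IsEspalier perp sim) {J : Finset I} {c : L}
    (h : IsFinOplus perp a J c) : ∀ i ∈ J, ∀ K : Set I, K ⊆ J → i ∉ K → ∀ d, IsLUB (a '' K) d →
      perp d (a i) := by
  induction h with
  | empty hz => simp
  | @cons J j hj b c hb hc ih =>
    intro i hi K hK hiK d hd
    have hbL := hb.isLUB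
    by_cases hjK : j ∈ K
    · have hij : i ≠ j := fun h => hiK (h ▸ hjK)
      have hiJ : i ∈ J := (Finset.mem_cons.1 hi).resolve_left hij
      have hKJ : K \ {j} ⊆ J := fun x hx => (Finset.mem_cons.1 (hK hx.1)).resolve_left hx.2
      obtain ⟨d', hd'⟩ := hL.exists_isLUB (X := a '' (K \ {j}))
        ⟨b, upperBounds_mono_set (Set.image_mono hKJ) hbL.1⟩
      have hp := ih i hiJ _ hKJ (fun h => hiK h.1) d' hd'
      have hd'b : d' ≤ b := hd'.2 (upperBounds_mono_set (Set.image_mono hKJ) hbL.1)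
      have hib : a i ≤ b := hbL.1 (Set.mem_image_of_mem a hiJ)
      obtain ⟨e, he⟩ := hL.exists_isLUB (X := {a i, d'}) ⟨b, by
        rintro _ (rfl | rfl) <;> assumption⟩
      have heb : e ≤ b := he.2 (by rintro _ (rfl | rfl) <;> assumption)
      refine hL.perp_symm _ _ (hL.perp_assoc (a i) d' (a j) e d ⟨c, ?_⟩ (hL.perp_symm _ _ hp) he ?_
        (hL.perp_of_le _ _ _ heb hc.1))
      · rintro _ (rfl | rfl | rfl)
        exacts [hib.trans hc.le_left, hd'b.trans hc.le_left, hc.le_right]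
      · rw [isLUB_insert_iff hd', ← Set.image_insert_eq, Set.insert_sdiff_singleton,
          Set.insert_eq_of_mem hjK]
        exact hd
    · have hKJ : K ⊆ J := fun x hx => (Finset.mem_cons.1 (hK hx)).resolve_left
        fun h => hjK (h ▸ hx)
      rcases Finset.mem_cons.1 hi with rfl | hiJ
      · exact hL.perp_of_le _ _ _ (hd.2 (upperBounds_mono_set (Set.image_mono hKJ) hbL.1)) hc.1
      · exact ih i hiJ K hKJ hiK d hd

theorem isFamOplus_of_perp (hL : IsEspalier perp sim) {c : L} (hc : IsLUB (Set.range a) c)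
    (h : ∀ i, ∀ K : Finset I, i ∉ K → ∀ d, IsLUB (a '' K) d → perp d (a i)) :
    IsFamOplus perp a c := by
  refine ⟨⟨⟨c, hc.1⟩, fun J => ?_⟩, hc⟩
  induction J using Finset.cons_induction with
  | empty =>
    obtain ⟨z, hz⟩ := hL.exists_isBot
    exact ⟨z, .empty hz⟩
  | cons j J hj ih =>
    obtain ⟨b, hb⟩ := ih
    have hbc : b ≤ c := hb.isLUB.2 (upperBounds_mono_set (Set.image_subset_range _ _) hc.1)
    obtain ⟨e, he⟩ := hL.exists_isLUB (X := {b, a j}) ⟨c, by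
      rintro _ (rfl | rfl)
      exacts [hbc, hc.1 (Set.mem_range_self j)]⟩
    exact ⟨e, .cons hj hb ⟨h j J hj b hb.isLUB, he⟩⟩

theorem perp_finset (hL : IsEspalier perp sim) {c : L} (h : IsFamOplus perp a c) {i : I}
    {K : Finset I} (hi : i ∉ K) {d : L} (hd : IsLUB (a '' K) d) : perp d (a i) := by
  obtain ⟨e, he⟩ := h.1.2 (Finset.cons i K hi)
  exact hL.perp_of_isFinOplus he i (Finset.mem_cons_self _ _) K
    (by rw [Finset.coe_cons]; exact Set.subset_insert _ _) hi d hd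

theorem perp_finset_finset (hL : IsEspalier perp sim) {c : L} (h : IsFamOplus perp a c)
    {K M : Finset I} (hKM : Disjoint K M) {d e : L} (hd : IsLUB (a '' K) d)
    (he : IsLUB (a '' M) e) : perp d e := by
  classical
  induction M using Finset.cons_induction generalizing e with
  | empty =>
    rw [Finset.coe_empty, Set.image_empty, isLUB_empty_iff] at he
    exact hL.perp_zero _ _ he
  | cons j M hj ih =>
    have hK : ∀ X : Set I, BddAbove (a '' X) := fun X =>
      ⟨c, upperBounds_mono_set (Set.image_subset_range _ _) h.2.1⟩
    rw [Finset.cons_eq_insert, Finset.disjoint_insert_right] at hKM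
    obtain ⟨e', he'⟩ := hL.exists_isLUB (hK M)
    obtain ⟨g, hg⟩ := hL.exists_isLUB (hK (K ∪ M : Finset I))
    have hjKM : j ∉ K ∪ M := by
      rw [Finset.mem_union]
      exact not_or.2 ⟨hKM.1, hj⟩
    have hle : ∀ X : Set I, ∀ w, IsLUB (a '' X) w → w ≤ c := fun X w hw =>
      hw.2 (upperBounds_mono_set (Set.image_subset_range _ _) h.2.1)
    refine hL.perp_assoc d e' (a j) g e ⟨c, ?_⟩ (ih hKM.2 he') ?_ ?_ (hL.perp_finset h hjKM hg)
    · rintro _ (rfl | rfl | rfl)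
      exacts [hle _ _ hd, hle _ _ he', h.2.1 (Set.mem_range_self j)]
    · rw [isLUB_pair_iff hd he', ← Set.image_union, ← Finset.coe_union]
      exact hg
    · rw [isLUB_insert_iff he', ← Set.image_insert_eq, ← Finset.coe_cons]
      exact he

theorem isFamOplus_comp (hL : IsEspalier perp sim) {c : L} (h : IsFamOplus perp a c)
    {J : Type u} {g : J → I} (hg : Function.Injective g) {d : L}
    (hd : IsLUB (Set.range fun j => a (g j)) d) : IsFamOplus perp (fun j => a (g j)) d := by
  refine hL.isFamOplus_of_perp hd fun i K hi e he =>
    hL.perp_finset h (i := g i) (K := K.map ⟨g, hg⟩) (fun hh => hi ?_) ?_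
  · obtain ⟨k, hk, hkg⟩ := Finset.mem_map.1 hh
    rwa [← hg hkg]
  · rw [Finset.coe_map, Set.image_image]
    exact he

theorem isFamOplus_equiv (hL : IsEspalier perp sim) {c : L} (h : IsFamOplus perp a c)
    {J : Type u} (e : J ≃ I) : IsFamOplus perp (fun j => a (e j)) c :=
  hL.isFamOplus_comp h e.injective (by
    rw [show (Set.range fun j => a (e j)) = Set.range a from e.surjective.range_comp a]
    exact h.2)

theorem bddAbove_image {c : L} (h : IsFamOplus perp a c) (A : Set I) : BddAbove (a '' A) :=
  ⟨c, upperBounds_mono_set (Set.image_subset_range _ _) h.2.1⟩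

theorem isFamOplus_restrict (hL : IsEspalier perp sim) {c : L} (h : IsFamOplus perp a c)
    (A : Set I) {d : L} (hd : IsLUB (a '' A) d) : IsFamOplus perp (fun i : A => a i) d :=
  hL.isFamOplus_comp h Subtype.val_injective (by
    rw [Set.image_eq_range] at hd
    exact hd)

/-- Suprema over disjoint sets of indices of an orthogonal family are orthogonal. -/
theorem perp_of_disjoint (hL : IsEspalier perp sim) {c : L} (h : IsFamOplus perp a c)
    {A B : Set I} (hAB : Disjoint A B) {d e : L} (hd : IsLUB (a '' A) d)
    (he : IsLUB (a '' B) e) : perp d e := by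
  -- The passage to infinite sets uses `perp_famOplus` twice: over `B` against finite parts of `A`,
  -- then over `A`.
  have hfin : ∀ (K : Finset I), (K : Set I) ⊆ A → ∀ w, IsLUB (a '' K) w → perp w e := by
    intro K hKA w hw
    refine hL.perp_famOplus w B _ e (hL.isFamOplus_restrict h B he) fun J v hv => ?_
    refine hL.perp_finset_finset h (K := K) (M := J.map ⟨_, Subtype.val_injective⟩) ?_ hw ?_
    · rw [Finset.disjoint_left]
      rintro x hxK hxJ
      obtain ⟨y, -, rfl⟩ := Finset.mem_map.1 hxJ
      exact Set.disjoint_left.1 hAB (hKA hxK) y.2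
    · rw [Finset.coe_map, Set.image_image]
      exact hv.isLUB
  refine hL.perp_symm _ _ (hL.perp_famOplus e A _ d (hL.isFamOplus_restrict h A hd)
    fun J v hv => hL.perp_symm _ _ (hfin (J.map ⟨_, Subtype.val_injective⟩) ?_ v ?_))
  · intro x hx
    obtain ⟨y, -, rfl⟩ := Finset.mem_map.1 (Finset.mem_coe.1 hx)
    exact y.2
  · rw [Finset.coe_map, Set.image_image]
    exact hv.isLUB

theorem isFamOplus_bool (hL : IsEspalier perp sim) {x y c : L} :
    IsFamOplus perp (fun i : ULift.{u} Bool => cond i.down x y) c ↔ IsOplus perp x y c := by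
  have hr : (Set.range fun i : ULift.{u} Bool => cond i.down x y) = {x, y} := by
    ext w
    simp [ULift.exists, eq_comm, or_comm]
  constructor
  · intro h
    refine ⟨hL.perp_of_disjoint h (A := {⟨true⟩}) (B := {⟨false⟩}) (by simp) ?_ ?_, hr ▸ h.2⟩
    · rw [Set.image_singleton]; exact isLUB_singleton
    · rw [Set.image_singleton]; exact isLUB_singleton
  · intro h
    refine hL.isFamOplus_of_perp (hr ▸ h.2) fun i K hi d hd => ?_
    obtain ⟨_ | _⟩ := i
    · refine hL.perp_of_le _ _ _ (hd.2 ?_) h.1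
      rintro _ ⟨⟨_ | _⟩, hk, rfl⟩
      exacts [(hi hk).elim, le_rfl]
    · refine hL.perp_of_le _ _ _ (hd.2 ?_) (hL.perp_symm _ _ h.1)
      rintro _ ⟨⟨_ | _⟩, hk, rfl⟩
      exacts [le_rfl, (hi hk).elim]

theorem isFamOplus_punit (hL : IsEspalier perp sim) (x : L) :
    IsFamOplus perp (fun _ : PUnit.{u + 1} => x) x := by
  refine hL.isFamOplus_of_perp (by rw [Set.range_const]; exact isLUB_singleton)
    fun i K hi d hd => hL.perp_symm _ _ (hL.perp_zero _ _ ?_)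
  have : K = ∅ := Finset.eq_empty_of_forall_notMem fun j hj => hi hj
  rwa [this, Finset.coe_empty, Set.image_empty, isLUB_empty_iff] at hd

theorem isFamOplus_fiber (hL : IsEspalier perp sim) {J : I → Type u} {f : (Σ i, J i) → L} {c : L}
    (h : IsFamOplus perp f c) :
    ∃ b : I → L, (∀ i, IsFamOplus perp (fun j => f ⟨i, j⟩) (b i)) ∧ IsFamOplus perp b c := by
  have him : ∀ i, (Set.range fun j => f ⟨i, j⟩) = f '' (Sigma.fst ⁻¹' {i}) := by
    intro i
    rw [← Set.range_sigmaMk i, ← Set.range_comp]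
    rfl
  choose b hb using fun i => hL.exists_isLUB (bddAbove_image h (Sigma.fst ⁻¹' {i}))
  have hbA : ∀ A : Set I, ∀ d, IsLUB (b '' A) d ↔ IsLUB (f '' (Sigma.fst ⁻¹' A)) d := by
    intro A d
    have : upperBounds (b '' A) = upperBounds (f '' (Sigma.fst ⁻¹' A)) := by
      ext u
      constructor
      · rintro hu _ ⟨⟨i, j⟩, hi, rfl⟩
        exact ((hb i).1 ⟨⟨i, j⟩, rfl, rfl⟩).trans (hu ⟨i, hi, rfl⟩)
      · rintro hu _ ⟨i, hi, rfl⟩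
        refine (hb i).2 ?_
        rintro _ ⟨⟨i, j⟩, rfl, rfl⟩
        exact hu ⟨⟨i, j⟩, hi, rfl⟩
    rw [IsLUB, IsLUB, this]
  refine ⟨b, fun i => hL.isFamOplus_comp h sigma_mk_injective (him i ▸ hb i),
    hL.isFamOplus_of_perp ?_ fun i K hi d hd => ?_⟩
  · rw [← Set.image_univ, hbA, Set.preimage_univ, Set.image_univ]
    exact h.2
  · rw [hbA] at hd
    refine hL.perp_of_disjoint h ?_ hd (hb i)
    exact Set.disjoint_left.2 fun x hx hxi => hi (Finset.mem_coe.1 (by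
      rw [← Set.mem_singleton_iff.1 hxi]; exact hx))

theorem isFamOplus_sigma (hL : IsEspalier perp sim) {J : I → Type u} {f : (Σ i, J i) → L}
    {b : I → L} {c : L} (h : ∀ i, IsFamOplus perp (fun j => f ⟨i, j⟩) (b i))
    (hb : IsFamOplus perp b c) : IsFamOplus perp f c := by
  have hfb : ∀ x, f x ≤ b x.1 := fun x => (h x.1).2.1 ⟨x.2, rfl⟩
  have hfc : ∀ x, f x ≤ c := fun x => (hfb x).trans (hb.2.1 ⟨x.1, rfl⟩)
  refine hL.isFamOplus_of_perp ⟨?_, fun w hw => hb.2.2 ?_⟩ ?_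
  · rintro _ ⟨x, rfl⟩
    exact hfc x
  · rintro _ ⟨i, rfl⟩
    refine (h i).2.2 ?_
    rintro _ ⟨j, rfl⟩
    exact hw ⟨_, rfl⟩
  · rintro ⟨i, j⟩ K hK d hd
    have hbd : ∀ X, BddAbove (f '' X) := fun X => ⟨c, by rintro _ ⟨x, -, rfl⟩; exact hfc x⟩
    -- Split `K` into its part over `i` and the rest. The first is orthogonal to the given term
    -- within the fibre; both lie below `b i`, which is orthogonal to the rest.
    obtain ⟨d0, hd0⟩ := hL.exists_isLUB (hbd (K ∩ Sigma.fst ⁻¹' {i}))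
    obtain ⟨d1, hd1⟩ := hL.exists_isLUB (hbd (K \ Sigma.fst ⁻¹' {i}))
    obtain ⟨e, he⟩ := hL.exists_isLUB (bddAbove_image hb {i}ᶜ)
    have hd1e : d1 ≤ e := hd1.2 (by
      rintro _ ⟨x, hx, rfl⟩
      exact (hfb x).trans (he.1 ⟨x.1, hx.2, rfl⟩))
    have hbe : perp (b i) e := hL.perp_of_disjoint hb (A := {i}) disjoint_compl_right
      (by rw [Set.image_singleton]; exact isLUB_singleton) he
    have hd0b : d0 ≤ b i := hd0.2 (by
      rintro _ ⟨x, ⟨-, rfl⟩, rfl⟩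
      exact hfb x)
    have hfi : f ⟨i, j⟩ ≤ b i := hfb ⟨i, j⟩
    have hp : perp (f ⟨i, j⟩) d0 := by
      refine hL.perp_of_disjoint (h i) (A := {j}) (B := {k | (⟨i, k⟩ : Σ i, J i) ∈ K})
        (Set.disjoint_singleton_left.2 hK) (by rw [Set.image_singleton]; exact isLUB_singleton) ?_
      convert hd0 using 1
      ext w
      constructor
      · rintro ⟨k, hk, rfl⟩
        exact ⟨⟨i, k⟩, ⟨hk, rfl⟩, rfl⟩
      · rintro ⟨⟨i, k⟩, ⟨hk, rfl⟩, rfl⟩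
        exact ⟨k, hk, rfl⟩
    obtain ⟨g, hg⟩ := hL.exists_isLUB (X := {f ⟨i, j⟩, d0}) ⟨b i, by
      rintro _ (rfl | rfl) <;> assumption⟩
    have hgb : g ≤ b i := hg.2 (by rintro _ (rfl | rfl) <;> assumption)
    refine hL.perp_symm _ _ (hL.perp_assoc _ d0 d1 g d ⟨c, ?_⟩ hp hg ?_
      (hL.perp_mono hbe hgb hd1e))
    · have hbc : b i ≤ c := hb.2.1 ⟨i, rfl⟩
      rintro _ (rfl | rfl | rfl)
      exacts [hfc _, hd0b.trans hbc, hd1.2 (by rintro _ ⟨x, -, rfl⟩; exact hfc x)]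
    · rw [isLUB_pair_iff hd0 hd1, ← Set.image_union, Set.inter_union_sdiff]
      exact hd

end Families

end IsEspalier

namespace IsEspalier

variable {L : Type u} [PartialOrder L] {perp : L → L → Prop} {sim : Setoid L}

/-! ### Sums of classes -/

/-- The class `γ` is the sum of the family `α`. -/
def FamAdd (perp : L → L → Prop) (sim : Setoid L) {I : Type u} (α : I → Quotient sim)
    (γ : Quotient sim) : Prop :=
  ∃ a c, IsFamOplus perp a c ∧ (∀ i, Quotient.mk sim (a i) = α i) ∧ Quotient.mk sim c = γ

theorem famAdd_unique (hL : IsEspalier perp sim) {I : Type u} {α : I → Quotient sim}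
    {γ γ' : Quotient sim} (h : FamAdd perp sim α γ) (h' : FamAdd perp sim α γ') : γ = γ' := by
  obtain ⟨a, c, hac, ha, rfl⟩ := h
  obtain ⟨b, d, hbd, hb, rfl⟩ := h'
  exact Quotient.sound (hL.sim_add I a b c d hac hbd fun i => Quotient.exact ((ha i).trans (hb i).symm))

theorem exists_of_famAdd (hL : IsEspalier perp sim) {I : Type u} {α : I → Quotient sim} {c : L}
    (h : FamAdd perp sim α (Quotient.mk sim c)) :
    ∃ a, IsFamOplus perp a c ∧ ∀ i, Quotient.mk sim (a i) = α i := by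
  obtain ⟨b, d, hbd, hb, hdc⟩ := h
  obtain ⟨a, ha, hab⟩ := hL.sim_refine c I b d hbd (sim.symm (Quotient.exact hdc))
  exact ⟨a, ha, fun i => (Quotient.sound (hab i)).trans (hb i)⟩

theorem famAdd_bool (hL : IsEspalier perp sim) {α : ULift.{u} Bool → Quotient sim}
    {γ : Quotient sim} : FamAdd perp sim α γ ↔ dimAdd perp sim (α ⟨true⟩) (α ⟨false⟩) γ := by
  constructor
  · rintro ⟨a, c, hac, ha, rfl⟩
    refine ⟨a ⟨true⟩, a ⟨false⟩, c, (ha _).symm, (ha _).symm, rfl, hL.isFamOplus_bool.1 ?_⟩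
    convert hac using 1
    funext ⟨i⟩
    cases i <;> rfl
  · rintro ⟨a, b, c, ha, hb, rfl, h⟩
    refine ⟨_, c, hL.isFamOplus_bool.2 h, ?_, rfl⟩
    rintro ⟨_ | _⟩
    exacts [hb.symm, ha.symm]

theorem exists_of_dimAdd (hL : IsEspalier perp sim) {α β : Quotient sim} {c : L}
    (h : dimAdd perp sim α β (Quotient.mk sim c)) :
    ∃ a b, Quotient.mk sim a = α ∧ Quotient.mk sim b = β ∧ IsOplus perp a b c := by
  obtain ⟨a, ha, haα⟩ := hL.exists_of_famAdd
    ((hL.famAdd_bool (α := fun i => cond i.down α β)).2 h)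
  refine ⟨_, _, haα ⟨true⟩, haα ⟨false⟩, hL.isFamOplus_bool.1 ?_⟩
  convert ha using 1
  funext ⟨i⟩
  cases i <;> rfl

theorem dimAdd_mk {a b c : L} (h : IsOplus perp a b c) :
    dimAdd perp sim (Quotient.mk sim a) (Quotient.mk sim b) (Quotient.mk sim c) :=
  ⟨a, b, c, rfl, rfl, rfl, h⟩

theorem dimAdd_unique (hL : IsEspalier perp sim) {α β γ γ' : Quotient sim}
    (h : dimAdd perp sim α β γ) (h' : dimAdd perp sim α β γ') : γ = γ' :=
  hL.famAdd_unique ((hL.famAdd_bool (α := fun i => cond i.down α β)).2 h)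
    ((hL.famAdd_bool (α := fun i => cond i.down α β)).2 h')

theorem dimAdd_comm (hL : IsEspalier perp sim) {α β γ : Quotient sim}
    (h : dimAdd perp sim α β γ) : dimAdd perp sim β α γ := by
  obtain ⟨a, b, c, rfl, rfl, rfl, h⟩ := h
  exact dimAdd_mk (hL.oplus_symm h)

theorem dimAdd_assoc (hL : IsEspalier perp sim) {α β γ δ ξ : Quotient sim}
    (h1 : dimAdd perp sim α β ξ) (h2 : dimAdd perp sim ξ γ δ) :
    ∃ η, dimAdd perp sim β γ η ∧ dimAdd perp sim α η δ := by
  obtain ⟨x, c, d, rfl, rfl, rfl, hd⟩ := h2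
  obtain ⟨a, b, rfl, rfl, hx⟩ := hL.exists_of_dimAdd h1
  obtain ⟨y, hy, hy'⟩ := hL.oplus_assoc hx hd
  exact ⟨_, dimAdd_mk hy, dimAdd_mk hy'⟩

/-- Realize both sums in one element as `c = a ⊕ a' = b ⊕ b'`. The refinement consists of the
classes of `a ∧ b`, of its complements in `a` and in `b`, and of the complement of `a ∨ b` in `c`;
`parallelogram` moves the middle two above `b` and `a`. -/
theorem dimAdd_refinement (hL : IsEspalier perp sim) {α₀ α₁ β₀ β₁ σ : Quotient sim}
    (h : dimAdd perp sim α₀ α₁ σ) (h' : dimAdd perp sim β₀ β₁ σ) :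
    ∃ c₀₀ c₀₁ c₁₀ c₁₁, dimAdd perp sim c₀₀ c₀₁ α₀ ∧ dimAdd perp sim c₁₀ c₁₁ α₁ ∧
      dimAdd perp sim c₀₀ c₁₀ β₀ ∧ dimAdd perp sim c₀₁ c₁₁ β₁ := by
  obtain ⟨a, a', c, rfl, rfl, rfl, ha⟩ := h
  obtain ⟨b, b', rfl, rfl, hb⟩ := hL.exists_of_dimAdd h'
  obtain ⟨m, hm⟩ := hL.exists_inf {a, b} ⟨a, Set.mem_insert _ _⟩
  obtain ⟨j, hj⟩ := hL.exists_isLUB (X := {a, b}) ⟨c, by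
    rintro _ (rfl | rfl)
    exacts [ha.le_left, hb.le_left]⟩
  have hjc : j ≤ c := hj.2 (by
    rintro _ (rfl | rfl)
    exacts [ha.le_left, hb.le_left])
  have hja : a ≤ j := hj.1 (Set.mem_insert _ _)
  have hjb : b ≤ j := hj.1 (Set.mem_insert_of_mem _ rfl)
  obtain ⟨x, hx⟩ := hL.exists_oplus m a (hm.1 (Set.mem_insert _ _))
  obtain ⟨x', hx'⟩ := hL.exists_oplus m b (hm.1 (Set.mem_insert_of_mem _ rfl))
  obtain ⟨y, hy⟩ := hL.exists_oplus b j hjb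
  obtain ⟨y', hy'⟩ := hL.exists_oplus a j hja
  obtain ⟨z, hz⟩ := hL.exists_oplus j c hjc
  have hxy : sim x y := hL.parallelogram a b x y m j hm hj hx hy
  have hxy' : sim x' y' := hL.parallelogram b a x' y' m j (by rwa [Set.pair_comm])
    (by rwa [Set.pair_comm]) hx' hy'
  obtain ⟨v, hv, hv'⟩ := hL.oplus_assoc hy hz
  obtain ⟨w, hw, hw'⟩ := hL.oplus_assoc hy' hz
  have h1 : Quotient.mk sim v = Quotient.mk sim b' := Quotient.sound (hL.sim_of_oplus hv' hb)
  have h2 : Quotient.mk sim w = Quotient.mk sim a' := Quotient.sound (hL.sim_of_oplus hw' ha)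
  have h3 : Quotient.mk sim x = Quotient.mk sim y := Quotient.sound hxy
  have h4 : Quotient.mk sim x' = Quotient.mk sim y' := Quotient.sound hxy'
  refine ⟨_, _, _, Quotient.mk sim z, dimAdd_mk hx, ?_, dimAdd_mk hx', ?_⟩
  · rw [h4, ← h2]; exact dimAdd_mk hw
  · rw [h3, ← h1]; exact dimAdd_mk hv

/-! ### Orthogonality to sums, absorbed classes and exhaustion -/

/-- By `parallelogram`, the part of `z` outside `z ∧ e` is equivalent to a part of `d`, so it
vanishes. -/
theorem le_of_oplus_of_orth (hL : IsEspalier perp sim) {d e g z : L} (h : IsOplus perp d e g)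
    (hz : z ≤ g) (ho : ∀ x ≤ z, ∀ y ≤ d, sim x y → IsBot x) : z ≤ e := by
  obtain ⟨m, hm⟩ := hL.exists_inf {z, e} ⟨z, Set.mem_insert _ _⟩
  have hb : g ∈ upperBounds {z, e} := by
    rintro _ (rfl | rfl)
    exacts [hz, h.le_right]
  obtain ⟨j, hj⟩ := hL.exists_isLUB ⟨g, hb⟩
  obtain ⟨x, hx⟩ := hL.exists_oplus m z (hm.1 (Set.mem_insert _ _))
  obtain ⟨y, hy⟩ := hL.exists_oplus e j (hj.1 (Set.mem_insert_of_mem _ rfl))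
  obtain ⟨w, hw⟩ := hL.exists_oplus j g (hj.2 hb)
  have hxy := hL.parallelogram z e x y m j hm hj hx hy
  obtain ⟨v, hv, hv'⟩ := hL.oplus_assoc hy hw
  have hvd : Quotient.mk sim v = Quotient.mk sim d :=
    Quotient.sound (hL.sim_of_oplus hv' (hL.oplus_symm h))
  obtain ⟨y', w', hy', -, hd⟩ := hL.exists_of_dimAdd (hvd ▸ dimAdd_mk (sim := sim) hv)
  have hx0 := ho x hx.le_right y' hd.le_left (sim.trans hxy (sim.symm (Quotient.exact hy')))
  have hzm : z ≤ m := hx.2.2 (by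
    rintro _ (rfl | rfl)
    exacts [le_rfl, hx0 _])
  exact hzm.trans (hm.1 (Set.mem_insert_of_mem _ rfl))

/-- Peeling off terms one by one puts `z` below the complement of each finite partial sum, so `z` is
orthogonal to all of them. By `perp_famOplus` it is orthogonal to `c`, and `z ≤ c`. -/
theorem isBot_of_le_famOplus (hL : IsEspalier perp sim) {I : Type u} {a : I → L} {c z : L}
    (h : IsFamOplus perp a c) (hz : z ≤ c)
    (ho : ∀ i, ∀ x ≤ z, ∀ y ≤ a i, sim x y → IsBot x) : IsBot z := by
  have key : ∀ (J : Finset I) (d : L), IsFinOplus perp a J d → ∀ e g, IsOplus perp d e g →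
      z ≤ g → z ≤ e := by
    intro J d hd
    induction hd with
    | empty hb =>
      intro e g hg hzg
      refine hzg.trans (hg.2.2 ?_)
      rintro _ (rfl | rfl)
      exacts [hb _, le_rfl]
    | @cons J j hj b d hb hd ih =>
      intro e g hg hzg
      obtain ⟨y, hy, hy'⟩ := hL.oplus_assoc hd hg
      exact hL.le_of_oplus_of_orth hy (ih y g hy' hzg) (ho j)
  refine hL.isBot_of_perp (hL.perp_famOplus z I a c h fun J d hd => ?_) le_rfl hz
  obtain ⟨e, he⟩ := hL.exists_oplus d c
    (hd.isLUB.2 (upperBounds_mono_set (Set.image_subset_range _ _) h.2.1))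
  exact hL.perp_of_le _ _ _ (key J d hd e c he hz) (hL.perp_symm _ _ he.1)

/-- Since `α = ζ + α`, a piece of class `ζ` splits off a representative and leaves a remainder of
the same class `α`. Iterating inside a fixed `c` gives an orthogonal sequence bounded by `c`. -/
theorem exists_sequence (hL : IsEspalier perp sim) {α ζ : Quotient sim}
    (h : dimAdd perp sim ζ α α) :
    ∃ σ ρ, FamAdd perp sim (fun _ : ULift.{u} ℕ => ζ) σ ∧ dimAdd perp sim σ ρ α := by
  obtain ⟨c, rfl⟩ := Quotient.exists_rep α
  have step : ∀ r : {r : L // Quotient.mk sim r = Quotient.mk sim c},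
      ∃ (z : L) (r' : {r : L // Quotient.mk sim r = Quotient.mk sim c}),
        Quotient.mk sim z = ζ ∧ IsOplus perp z r' r := by
    rintro ⟨r, hr⟩
    obtain ⟨z, r', hz, hr', ho⟩ := hL.exists_of_dimAdd (c := r) (hr.symm ▸ h)
    exact ⟨z, ⟨r', hr'.trans hr⟩, hz, ho⟩
  choose f g hf hfg using step
  let R : ℕ → {r : L // Quotient.mk sim r = Quotient.mk sim c} := fun n => g^[n] ⟨c, rfl⟩
  let z : ULift.{u} ℕ → L := fun n => f (R n.down)
  have hR : ∀ n, IsOplus perp (z ⟨n⟩) (R (n + 1)) (R n) := fun n => by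
    have := hfg (R n)
    rwa [show g (R n) = R (n + 1) from (Function.iterate_succ_apply' g n _).symm] at this
  let J : ℕ → Finset (ULift.{u} ℕ) := fun n => (Finset.range n).map Equiv.ulift.symm.toEmbedding
  have hJ : ∀ n m, (⟨m⟩ : ULift.{u} ℕ) ∈ J n ↔ m < n := fun n m => by
    simp only [J, Finset.mem_map, Finset.mem_range]
    constructor
    · rintro ⟨k, hk, hkm⟩
      rwa [← show k = m from congrArg ULift.down hkm]
    · intro hm
      exact ⟨m, hm, rfl⟩
  have hJs : ∀ n, J (n + 1) = Finset.cons ⟨n⟩ (J n) (fun hh => lt_irrefl n ((hJ n n).1 hh)) := by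
    intro n
    ext ⟨m⟩
    rw [Finset.mem_cons, hJ, hJ, ULift.ext_iff, Nat.lt_succ_iff_lt_or_eq, or_comm]
  have hD : ∀ n, ∃ d, IsFinOplus perp z (J n) d ∧ IsOplus perp d (R n) c := by
    intro n
    induction n with
    | zero =>
      obtain ⟨b, hb⟩ := hL.exists_isBot
      refine ⟨b, ?_, hL.oplus_symm (hL.oplus_bot hb c)⟩
      exact IsFinOplus.empty hb
    | succ n ih =>
      obtain ⟨d, hd, hdc⟩ := ih
      obtain ⟨x, hx, hx'⟩ := hL.oplus_assoc' (hR n) hdc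
      exact ⟨x, by rw [hJs]; exact .cons _ hd hx, hx'⟩
  have hzc : c ∈ upperBounds (Set.range z) := by
    rintro _ ⟨⟨n⟩, rfl⟩
    obtain ⟨d, -, hdc⟩ := hD n
    exact (hR n).le_left.trans hdc.le_right
  obtain ⟨s, hs⟩ := hL.exists_isLUB ⟨c, hzc⟩
  obtain ⟨r, hr⟩ := hL.exists_oplus s c (hs.2 hzc)
  refine ⟨_, _, ⟨z, s, hL.isFamOplus_of_perp hs fun i K hi d hd => ?_, fun i => hf _, rfl⟩,
    dimAdd_mk hr⟩
  obtain ⟨n, hn⟩ := (insert i K).exists_le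
  obtain ⟨e, he, -⟩ := hD (n.down + 1)
  have hmem : ∀ k ∈ insert i K, k ∈ J (n.down + 1) := fun k hk =>
    (hJ _ _).2 (Nat.lt_succ_of_le (hn k hk))
  exact hL.perp_of_isFinOplus he i (hmem i (Finset.mem_insert_self _ _)) K
    (fun k hk => hmem k (Finset.mem_insert_of_mem hk)) hi d hd

theorem exists_exhaustion (hL : IsEspalier perp sim) {K : Type u} [Nonempty K] (c : K → L)
    (P : Quotient sim → Prop) :
    ∃ (I : Type u) (τ : I → Quotient sim) (s r : K → L), (∀ i, P (τ i)) ∧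
      (∀ k, FamAdd perp sim τ (Quotient.mk sim (s k)) ∧ IsOplus perp (s k) (r k) (c k)) ∧
      ∀ x : K → L, ∀ ξ, P ξ → (∀ k, Quotient.mk sim (x k) = ξ) → (∀ k, x k ≤ r k) →
        ∀ k, IsBot (x k) := by
  -- A member `f` of `A` packages one class together with a representative inside each `c k`, so
  -- that all the `c k` are exhausted simultaneously. Orthogonality involves finite subsets only,
  -- hence passes to unions of chains.
  let 𝒜 : Set (Set (K → L)) := {A | (∀ f ∈ A, ∃ ξ, P ξ ∧ ∀ k, Quotient.mk sim (f k) = ξ) ∧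
    ∀ k, (∀ f ∈ A, f k ≤ c k) ∧ ∀ (f : K → L) (M : Finset (K → L)), f ∈ A → (M : Set (K → L)) ⊆ A →
      f ∉ M → ∀ d, IsLUB ((fun f => f k) '' (M : Set (K → L))) d → perp d (f k)}
  obtain ⟨A, hA⟩ := zorn_subset 𝒜 (by
    intro C hC hch
    refine ⟨⋃₀ C, ⟨?_, fun k => ⟨?_, ?_⟩⟩, fun s hs => Set.subset_sUnion_of_mem hs⟩
    · rintro f ⟨B, hB, hf⟩
      exact (hC hB).1 f hf
    · rintro f ⟨B, hB, hf⟩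
      exact ((hC hB).2 k).1 f hf
    · classical
      rintro f M hf hM hfM d hd
      have hne : C.Nonempty := let ⟨B, hB, _⟩ := hf; ⟨B, hB⟩
      obtain ⟨B, hB, hMB⟩ := DirectedOn.exists_mem_subset_of_finset_subset_biUnion (f := id)
        (s := insert f M) hne
        (by simpa [Function.onFun] using hch.directedOn) (by
          rw [Finset.coe_insert, show ⋃ i ∈ C, id i = ⋃₀ C from Set.sUnion_eq_biUnion.symm]
          exact Set.insert_subset hf hM)
      rw [Finset.coe_insert] at hMB
      exact ((hC hB).2 k).2 f M (hMB (Set.mem_insert _ _))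
        ((Set.subset_insert _ _).trans hMB) hfM d hd)
  obtain ⟨⟨hAP, hAo⟩, hmax⟩ := hA
  have : Nonempty (Quotient sim) := hL.nonempty.map (Quotient.mk sim)
  choose! ξ hξP hξ using hAP
  have hub : ∀ k, c k ∈ upperBounds (Set.range fun f : A => f.1 k) := by
    rintro k _ ⟨f, rfl⟩
    exact (hAo k).1 f.1 f.2
  choose s hs using fun k => hL.exists_isLUB ⟨c k, hub k⟩
  choose r hr using fun k => hL.exists_oplus (s k) (c k) ((hs k).2 (hub k))
  have hfam : ∀ k, IsFamOplus perp (fun f : A => f.1 k) (s k) := by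
    intro k
    refine hL.isFamOplus_of_perp (hs k) fun f M hf d hd => ?_
    refine (hAo k).2 f.1 (M.map ⟨_, Subtype.val_injective⟩) f.2 ?_ ?_ d ?_
    · intro x hx
      obtain ⟨y, -, rfl⟩ := Finset.mem_map.1 (Finset.mem_coe.1 hx)
      exact y.2
    · intro hh
      obtain ⟨y, hy, hyf⟩ := Finset.mem_map.1 hh
      exact hf (by rwa [← Subtype.ext hyf])
    · rw [Finset.coe_map, Set.image_image]
      exact hd
  refine ⟨A, fun f => ξ f.1, s, r, fun f => hξP _ f.2,
    fun k => ⟨⟨_, _, hfam k, fun f => hξ _ f.2 k, rfl⟩, hr k⟩, fun x η hη hx hxr => ?_⟩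
  have hnot : ∀ k, ¬ IsBot (x k) → False := by
    intro k₀ hk₀
    have hxs : ∀ k, perp (s k) (x k) := fun k => hL.perp_mono (hr k).1 le_rfl (hxr k)
    have hxA : x ∉ A := fun hx' => hk₀
      (hL.isBot_of_perp (hxs k₀) ((hs k₀).1 ⟨⟨x, hx'⟩, rfl⟩) le_rfl)
    refine hxA (hmax (y := insert x A) ⟨?_, fun k => ⟨?_, ?_⟩⟩ (Set.subset_insert _ _)
      (Set.mem_insert _ _))
    · rintro f (rfl | hf)
      exacts [⟨η, hη, hx⟩, ⟨ξ f, hξP f hf, hξ f hf⟩]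
    · rintro f (rfl | hf)
      exacts [(hxr k).trans (hr k).le_right, (hAo k).1 f hf]
    · classical
      have hle : ∀ f ∈ A, f k ≤ s k := fun f hf => (hs k).1 ⟨⟨f, hf⟩, rfl⟩
      have hA' : ∀ M : Finset (K → L), (M : Set (K → L)) ⊆ insert x A → x ∉ M →
          (M : Set (K → L)) ⊆ A := fun M hM hxM g hg =>
        (hM hg).resolve_left fun h => hxM (h ▸ hg)
      have hdle : ∀ M : Finset (K → L), (M : Set (K → L)) ⊆ A → ∀ d,
          IsLUB ((fun f => f k) '' (M : Set (K → L))) d → d ≤ s k := by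
        intro M hM d hd
        refine hd.2 ?_
        rintro _ ⟨g, hg, rfl⟩
        exact hle g (hM hg)
      rintro f M hf hM hfM d hd
      by_cases hfx : f = x
      · subst hfx
        exact hL.perp_of_le _ _ _ (hdle M (hA' M hM hfM) d hd) (hxs k)
      · have hfA : f ∈ A := hf.resolve_left hfx
        by_cases hxM : x ∈ M
        -- The supremum over `M` is `d' ∨ x k`. As `f k ∨ d'` is below `s k`, which is orthogonal to
        -- `x k`, `perp_assoc` applies.
        · have hMe : (M.erase x : Set (K → L)) ⊆ A := hA' _
            ((Finset.coe_subset.2 (Finset.erase_subset _ _)).trans hM) (Finset.notMem_erase _ _)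
          obtain ⟨d', hd'⟩ := hL.exists_isLUB
            (X := (fun f => f k) '' (M.erase x : Set (K → L))) ⟨s k, by
              rintro _ ⟨g, hg, rfl⟩
              exact hle g (hMe hg)⟩
          have hp := (hAo k).2 f (M.erase x) hfA hMe (fun h => hfM (Finset.mem_of_mem_erase h)) d' hd'
          have hub' : s k ∈ upperBounds {f k, d'} := by
            rintro _ (rfl | rfl)
            exacts [hle f hfA, hdle _ hMe _ hd']
          obtain ⟨g, hg⟩ := hL.exists_isLUB ⟨s k, hub'⟩
          refine hL.perp_symm _ _ (hL.perp_assoc (f k) d' (x k) g d ⟨c k, ?_⟩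
            (hL.perp_symm _ _ hp) hg ?_ (hL.perp_of_le _ _ _ (hg.2 hub') (hxs k)))
          · rintro _ (rfl | rfl | rfl)
            exacts [(hle f hfA).trans (hr k).le_left, (hdle _ hMe _ hd').trans (hr k).le_left,
              (hxr k).trans (hr k).le_right]
          · rw [isLUB_insert_iff hd', ← Set.image_insert_eq (f := fun f : K → L => f k),
              ← Finset.coe_insert, Finset.insert_erase hxM]
            exact hd
        · exact (hAo k).2 f M hfA (hA' M hM hxM) hfM d hd
  exact fun k => by_contra (hnot k)

end IsEspalier

namespace IsEspalier

open SumMonoid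

variable {L : Type u} [PartialOrder L] {perp : L → L → Prop} {sim : Setoid L}

/-! ### The dimension monoid of an espalier -/

open Classical in
/-- The sum of a family of classes; `none` stands for an undefined sum. -/
noncomputable def optSum (perp : L → L → Prop) (sim : Setoid L) {I : Type u}
    (f : I → Option (Quotient sim)) : Option (Quotient sim) :=
  if h : ∃ γ, ∃ α : I → Quotient sim, (∀ i, f i = some (α i)) ∧ FamAdd perp sim α γ then
    some h.choose else none

theorem optSum_eq_some (hL : IsEspalier perp sim) {I : Type u} {f : I → Option (Quotient sim)}
    {γ : Quotient sim} : optSum perp sim f = some γ ↔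
      ∃ α : I → Quotient sim, (∀ i, f i = some (α i)) ∧ FamAdd perp sim α γ := by
  rw [optSum]
  split_ifs with h
  · obtain ⟨α, hα, hαγ⟩ := h.choose_spec
    constructor
    · intro hγ
      exact ⟨α, hα, Option.some.inj hγ ▸ hαγ⟩
    · rintro ⟨β, hβ, hβγ⟩
      obtain rfl : β = α := funext fun i => Option.some.inj ((hβ i).symm.trans (hα i))
      rw [hL.famAdd_unique hαγ hβγ]
  · simp only [false_iff]
    exact fun h' => h ⟨γ, h'⟩

/-- The sum of two classes; `none` stands for an undefined sum. -/
noncomputable def optAdd (perp : L → L → Prop) (sim : Setoid L) (x y : Option (Quotient sim)) :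
    Option (Quotient sim) :=
  optSum perp sim fun i : ULift.{u} Bool => cond i.down x y

theorem optAdd_eq_some (hL : IsEspalier perp sim) {x y : Option (Quotient sim)}
    {γ : Quotient sim} : optAdd perp sim x y = some γ ↔
      ∃ α β, x = some α ∧ y = some β ∧ dimAdd perp sim α β γ := by
  rw [optAdd, hL.optSum_eq_some]
  constructor
  · rintro ⟨α, h, hα⟩
    exact ⟨_, _, h ⟨true⟩, h ⟨false⟩, hL.famAdd_bool.1 hα⟩
  · rintro ⟨α, β, rfl, rfl, h⟩
    refine ⟨fun i => cond i.down α β, ?_, hL.famAdd_bool.2 h⟩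
    rintro ⟨i⟩
    cases i <;> rfl

theorem optSum_sigma (hL : IsEspalier perp sim) {I : Type u} {J : I → Type u}
    (f : (Σ i, J i) → Option (Quotient sim)) :
    optSum perp sim (fun i => optSum perp sim fun j => f ⟨i, j⟩) = optSum perp sim f := by
  refine Option.ext fun γ => ?_
  rw [hL.optSum_eq_some, hL.optSum_eq_some]
  constructor
  · rintro ⟨β, hβ, hβγ⟩
    obtain ⟨c, rfl⟩ := Quotient.exists_rep γ
    obtain ⟨b, hb, hbβ⟩ := hL.exists_of_famAdd hβγ
    choose α hα hαβ using fun i => hL.optSum_eq_some.1 (hβ i)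
    choose a ha haα using fun i => hL.exists_of_famAdd (hbβ i ▸ hαβ i)
    exact ⟨fun x => α x.1 x.2, fun x => hα x.1 x.2,
      fun x => a x.1 x.2, c, hL.isFamOplus_sigma (f := fun x => a x.1 x.2) ha hb,
      fun x => haα x.1 x.2, rfl⟩
  · rintro ⟨α, hα, a, c, hac, ha, rfl⟩
    obtain ⟨b, hb, hbc⟩ := hL.isFamOplus_fiber hac
    exact ⟨fun i => Quotient.mk sim (b i), fun i => hL.optSum_eq_some.2
      ⟨fun j => α ⟨i, j⟩, fun j => hα _, _, _, hb i, fun j => ha _, rfl⟩,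
      b, c, hbc, fun _ => rfl, rfl⟩

theorem optSum_equiv (hL : IsEspalier perp sim) {I J : Type u} (e : I ≃ J)
    (f : J → Option (Quotient sim)) :
    optSum perp sim (fun i => f (e i)) = optSum perp sim f := by
  refine Option.ext fun γ => ?_
  rw [hL.optSum_eq_some, hL.optSum_eq_some]
  constructor
  · rintro ⟨α, hα, a, c, hac, ha, rfl⟩
    refine ⟨fun j => α (e.symm j), fun j => ?_, fun j => a (e.symm j), c,
      hL.isFamOplus_equiv hac e.symm, fun j => ha _, rfl⟩
    rw [← hα, e.apply_symm_apply]
  · rintro ⟨α, hα, a, c, hac, ha, rfl⟩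
    exact ⟨fun i => α (e i), fun i => hα _, fun i => a (e i), c, hL.isFamOplus_equiv hac e,
      fun i => ha _, rfl⟩

theorem optAdd_comm (hL : IsEspalier perp sim) (x y : Option (Quotient sim)) :
    optAdd perp sim x y = optAdd perp sim y x := by
  refine Option.ext fun γ => ?_
  rw [hL.optAdd_eq_some, hL.optAdd_eq_some]
  constructor <;> rintro ⟨α, β, rfl, rfl, h⟩ <;> exact ⟨β, α, rfl, rfl, hL.dimAdd_comm h⟩

theorem optAdd_assoc (hL : IsEspalier perp sim) (x y z : Option (Quotient sim)) :
    optAdd perp sim (optAdd perp sim x y) z = optAdd perp sim x (optAdd perp sim y z) := by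
  have key : ∀ x y z γ, optAdd perp sim (optAdd perp sim x y) z = some γ →
      optAdd perp sim x (optAdd perp sim y z) = some γ := by
    intro x y z γ h
    obtain ⟨ξ, ζ, h1, rfl, h2⟩ := hL.optAdd_eq_some.1 h
    obtain ⟨α, β, rfl, rfl, h3⟩ := hL.optAdd_eq_some.1 h1
    obtain ⟨η, h4, h5⟩ := hL.dimAdd_assoc h3 h2
    exact hL.optAdd_eq_some.2 ⟨α, η, rfl, hL.optAdd_eq_some.2 ⟨β, ζ, rfl, rfl, h4⟩, h5⟩
  refine Option.ext fun γ => ⟨key x y z γ, fun h => ?_⟩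
  rw [hL.optAdd_comm, hL.optAdd_comm y z] at h
  rw [hL.optAdd_comm, hL.optAdd_comm x y]
  exact key z y x γ h

/-- Classes, with an additional element for undefined sums, form a monoid with sums. -/
@[reducible] noncomputable def sumMonoid (hL : IsEspalier perp sim) {z : L} (hz : IsBot z) :
    SumMonoid (Option (Quotient sim)) :=
  have hadd : ∀ a, optAdd perp sim a (some (Quotient.mk sim z)) = a := fun a => by
    refine Option.ext fun γ => ?_
    rw [hL.optAdd_eq_some]
    constructor
    · rintro ⟨α, β, rfl, hβ, h⟩
      obtain ⟨a, rfl⟩ := Quotient.exists_rep α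
      rw [hL.dimAdd_unique h (Option.some.inj hβ ▸ dimAdd_mk (hL.oplus_bot hz a))]
    · rintro rfl
      obtain ⟨a, rfl⟩ := Quotient.exists_rep γ
      exact ⟨_, _, rfl, rfl, dimAdd_mk (hL.oplus_bot hz a)⟩
  { add := optAdd perp sim
    zero := some (Quotient.mk sim z)
    add_assoc := hL.optAdd_assoc
    add_comm := hL.optAdd_comm
    add_zero := hadd
    zero_add := fun a => (hL.optAdd_comm _ _).trans (hadd a)
    nsmul := @nsmulRec _ ⟨some (Quotient.mk sim z)⟩ ⟨optAdd perp sim⟩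
    sum := optSum perp sim
    sum_equiv := hL.optSum_equiv
    sum_sigma := hL.optSum_sigma
    sum_punit := fun a => by
      refine Option.ext fun γ => ?_
      rw [hL.optSum_eq_some]
      have hF : FamAdd perp sim (fun _ : PUnit.{u + 1} => γ) γ := by
        obtain ⟨c, rfl⟩ := Quotient.exists_rep γ
        exact ⟨_, c, hL.isFamOplus_punit c, fun _ => rfl, rfl⟩
      constructor
      · rintro ⟨α, hα, h⟩
        obtain ⟨c, rfl⟩ := Quotient.exists_rep γ
        obtain ⟨c', hc'⟩ := Quotient.exists_rep (α ⟨⟩)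
        have : FamAdd perp sim α (α ⟨⟩) :=
          ⟨_, c', hL.isFamOplus_punit c', fun _ => hc', hc'⟩
        rw [hα ⟨⟩, hL.famAdd_unique h this]
      · rintro rfl
        exact ⟨_, fun _ => rfl, hF⟩
    sum_bool := fun _ _ => rfl }

theorem exists_le_of_optAdd (hL : IsEspalier perp sim) {x w : Option (Quotient sim)} {c : L}
    (h : some (Quotient.mk sim c) = optAdd perp sim x w) :
    ∃ y ≤ c, some (Quotient.mk sim y) = x := by
  obtain ⟨α, β, rfl, rfl, h'⟩ := hL.optAdd_eq_some.1 h.symm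
  obtain ⟨y, v, rfl, -, ho⟩ := hL.exists_of_dimAdd h'
  exact ⟨y, ho.le_left, rfl⟩

theorem exists_optAdd_of_le (hL : IsEspalier perp sim) {x c : L} (h : x ≤ c) :
    ∃ w, some (Quotient.mk sim c) = optAdd perp sim (some (Quotient.mk sim x)) w := by
  obtain ⟨y, hy⟩ := hL.exists_oplus x c h
  exact ⟨_, (hL.optAdd_eq_some.2 ⟨_, _, rfl, rfl, dimAdd_mk hy⟩).symm⟩

theorem optAdd_none (hL : IsEspalier perp sim) (x : Option (Quotient sim)) :
    optAdd perp sim x none = none := by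
  refine Option.eq_none_iff_forall_ne_some.2 fun γ h => ?_
  obtain ⟨_, _, -, h, -⟩ := hL.optAdd_eq_some.1 h
  cases h

theorem isBot_of_mk_eq (hL : IsEspalier perp sim) {z x : L} (hz : IsBot z)
    (h : Quotient.mk sim x = Quotient.mk sim z) : IsBot x :=
  (hL.eq_zero_of_sim x z hz (Quotient.exact h)).symm ▸ hz

/-- The dimension monoid of an espalier. -/
@[reducible] noncomputable def dimensionMonoid (hL : IsEspalier perp sim) {z : L} (hz : IsBot z) :
    DimensionMonoid (Option (Quotient sim)) :=
  letI := hL.sumMonoid hz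
  { hL.sumMonoid hz with
    le := fun a b => ∃ c, b = a + c
    lt := fun a b => (∃ c, b = a + c) ∧ ¬ ∃ c, a = b + c
    lt_iff_le_not_ge := fun _ _ => Iff.rfl
    le_refl := fun a => ⟨0, (add_zero a).symm⟩
    le_trans := by
      rintro a b c ⟨x, rfl⟩ ⟨y, rfl⟩
      exact ⟨x + y, add_assoc _ _ _⟩
    le_antisymm := by
      rintro a b ⟨x, hx⟩ ⟨y, hy⟩
      -- The Cantor-Bernstein argument needs countably many copies of an absorbed class;
      -- `exists_sequence` supplies them.
      refine eq_of_add_eq_of_add_eq (fun a w h => ?_) hx.symm hy.symm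
      change optAdd perp sim a w = a at h
      rcases a with _ | α
      · exact ⟨none, (hL.optAdd_none _).symm⟩
      · obtain ⟨_, ζ, hα, rfl, h'⟩ := hL.optAdd_eq_some.1 h
        obtain rfl := Option.some.inj hα
        obtain ⟨σ, ρ, hσ, hρ⟩ := hL.exists_sequence (hL.dimAdd_comm h')
        exact ⟨some ρ, (hL.optAdd_eq_some.2 ⟨σ, ρ, hL.optSum_eq_some.2 ⟨_, fun _ => rfl, hσ⟩, rfl,
          hρ⟩).symm⟩
    top := none
    le_top := fun a => ⟨none, (hL.optAdd_none a).symm⟩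
    le_iff_exists_add' := fun _ _ => Iff.rfl
    add_top' := hL.optAdd_none
    refinement := by
      intro a₀ a₁ b₀ b₁ h hne
      obtain ⟨σ, hσ⟩ := Option.ne_none_iff_exists'.1 hne
      obtain ⟨α₀, α₁, rfl, rfl, hα⟩ := hL.optAdd_eq_some.1 hσ
      obtain ⟨β₀, β₁, rfl, rfl, hβ⟩ := hL.optAdd_eq_some.1 (h.symm.trans hσ)
      obtain ⟨c₀₀, c₀₁, c₁₀, c₁₁, h0, h1, h2, h3⟩ := hL.dimAdd_refinement hα hβ
      exact ⟨some c₀₀, some c₀₁, some c₁₀, some c₁₁, hL.optAdd_eq_some.2 ⟨_, _, rfl, rfl, h0⟩,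
        hL.optAdd_eq_some.2 ⟨_, _, rfl, rfl, h1⟩, hL.optAdd_eq_some.2 ⟨_, _, rfl, rfl, h2⟩,
        hL.optAdd_eq_some.2 ⟨_, _, rfl, rfl, h3⟩⟩
    eq_zero_of_le_sum := by
      rintro I f w hne ⟨v, hv⟩ ho
      obtain ⟨σ, hσ⟩ := Option.ne_none_iff_exists'.1 hne
      obtain ⟨α, hα, a, c, hac, ha, rfl⟩ := hL.optSum_eq_some.1 hσ
      obtain ⟨y, hyc, rfl⟩ := hL.exists_le_of_optAdd (hσ.symm.trans hv)
      have hy : IsBot y := by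
        refine hL.isBot_of_le_famOplus hac hyc fun i x hxy x' hx' hs => ?_
        refine hL.isBot_of_mk_eq hz (Option.some.inj
          (ho i (some (Quotient.mk sim x)) (hL.exists_optAdd_of_le hxy) ?_))
        rw [hα i, ← ha i, show Quotient.mk sim x = Quotient.mk sim x' from Quotient.sound hs]
        exact hL.exists_optAdd_of_le hx'
      rw [le_antisymm (hy z) (hz y)]
      rfl
    exhaustion := by
      intro K _ c hc P
      choose γ hγ using fun k => Option.ne_none_iff_exists'.1 (hc k)
      choose d hd using fun k => Quotient.exists_rep (γ k)
      obtain ⟨I, τ, s, r, hP, hs, hr⟩ := hL.exists_exhaustion d fun ξ => P (some ξ)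
      refine ⟨I, fun i => some (τ i), fun k => some (Quotient.mk sim (r k)), hP, fun k => ?_,
        fun x hx hxr => ?_⟩
      · rw [hγ k, ← hd k]
        exact (hL.optAdd_eq_some.2 ⟨_, _, hL.optSum_eq_some.2 ⟨τ, fun _ => rfl, (hs k).1⟩, rfl,
          dimAdd_mk (hs k).2⟩).symm
      · choose v hv using hxr
        choose y hy hyx using fun k => hL.exists_le_of_optAdd (hv k)
        obtain ⟨k₀⟩ := (inferInstance : Nonempty K)
        have hb := hr y (Quotient.mk sim (y k₀)) (by rwa [hyx])
          (fun k => Option.some.inj ((hyx k).trans (hyx k₀).symm)) hy k₀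
        rw [← hyx k₀, le_antisymm (hb z) (hz (y k₀))]
        rfl }

end IsEspalier

namespace DimensionMonoid

open PartialMon

variable {S T : Type u} [DimensionMonoid T]

/-- The elements below the top of a dimension monoid form a continuous dimension scale. -/
theorem isContinuousDimensionScale (ι : S → T) (hinj : Function.Injective ι) (hne : ∀ s, ι s ≠ ⊤)
    (hsurj : ∀ t ≠ ⊤, ∃ s, ι s = t) {add : S → S → S → Prop} {zero : S}
    (hadd : ∀ a b c, add a b c ↔ ι a + ι b = ι c) (h0 : ι zero = 0) :
    IsContinuousDimensionScale add zero := by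
  have hle : ∀ a b, AlgLE add a b ↔ ι a ≤ ι b := by
    intro a b
    constructor
    · rintro ⟨x, hx⟩
      exact (hadd _ _ _).1 hx ▸ le_self_add
    · intro h
      obtain ⟨d, hd⟩ := exists_add_of_le h
      obtain ⟨x, rfl⟩ := hsurj d (ne_top_of_le (hne b) (hd ▸ le_add_self))
      exact ⟨x, (hadd _ _ _).2 hd.symm⟩
  have horth : ∀ a b, PartialMon.Orth add zero a b ↔ DimensionMonoid.Orth (ι a) (ι b) := by
    intro a b
    constructor
    · intro h x hxa hxb
      obtain ⟨s, rfl⟩ := hsurj x (ne_top_of_le (hne a) hxa)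
      rw [h s ((hle _ _).2 hxa) ((hle _ _).2 hxb), h0]
    · intro h x hxa hxb
      exact hinj ((h _ ((hle _ _).1 hxa) ((hle _ _).1 hxb)).trans h0.symm)
  have horthSet : ∀ (Y : Set S) s, s ∈ orthSet add zero Y ↔ ι s ∈ oc (ι '' Y) := by
    intro Y s
    constructor
    · intro h
      refine ⟨hne s, ?_⟩
      rintro _ ⟨y, hy, rfl⟩
      exact (horth _ _).1 (h y hy)
    · intro h y hy
      exact (horth _ _).2 (h.2 _ ⟨y, hy, rfl⟩)
  choose p hp using fun (X : Set T) (s : S) => hsurj (off X (ι s)) (off_ne_top X (hne s))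
  have hpr : ∀ X s, s ∈ Set.range (p X) ↔ ι s ∈ oc X := by
    intro X s
    constructor
    · rintro ⟨s, rfl⟩
      rw [hp]
      exact off_mem X (hne s)
    · intro h
      exact ⟨s, hinj ((hp X s).trans (off_eq_self h))⟩
  have himg : ∀ X, ι '' Set.range (p X) = oc X := by
    intro X
    ext t
    constructor
    · rintro ⟨s, hs, rfl⟩
      exact (hpr X s).1 hs
    · intro ht
      obtain ⟨s, rfl⟩ := hsurj t ht.1
      exact ⟨s, (hpr X s).2 ht, rfl⟩
  have hpp : ∀ X, IsProjection add zero (p X) := by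
    refine fun X => ⟨hinj ?_, fun a b c h => ?_, fun x => ⟨p (oc X) x, ?_, ?_⟩⟩
    · rw [hp, h0, le_zero_iff.1 (off_le X (0 : T))]
    · rw [hadd] at h
      rw [hadd, hp, hp, hp, ← off_add X (h ▸ hne c), h]
    · rw [horthSet, himg, hp]
      exact off_mem _ (hne x)
    · rw [hadd, hp, hp, off_add_off X (hne x)]
  have hcompl : ∀ X, IsComplProjection add zero (p X) (p (oc X)) := by
    refine fun X => ⟨hpp _, ?_, ?_⟩
    · ext s
      rw [hpr, horthSet, himg]
    · ext s
      rw [hpr, Set.mem_ofPred_eq, ← hinj.eq_iff, hp, h0]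
      constructor
      · intro h
        rw [← off_add_off X (hne s), h, add_zero]
        exact off_mem X (hne s)
      · intro h
        exact off_eq_zero (mem_oc_oc (hne s) h)
  have hall : ∀ q, IsProjection add zero q → ∃ X, ∀ s, ι (q s) = off X (ι s) := by
    intro q hq
    -- The decomposition attached to `q` is the band decomposition for the band generated by its
    -- range, so `q` is a component map.
    refine ⟨oc (ι '' Set.range q), fun s => ?_⟩
    obtain ⟨y, hy, hs⟩ := hq.decomp s
    refine (off_eq (hne s) ((hadd _ _ _).1 hs).symm (mem_oc_oc (hne _)
      (Set.mem_image_of_mem ι (Set.mem_range_self s))) ?_).symm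
    rw [oc_oc_oc]
    exact (horthSet _ _).1 hy
  have hpinf : ∀ a, IsPurelyInfinite add a ↔ PInf (ι a) := fun a => hadd a a a
  have hrem : ∀ a b, IsRemovable add a b ↔ Rem (ι a) (ι b) := by
    intro a b
    refine and_congr (hle a b) ⟨fun h x hx hbx => ?_, fun h x s hs hbs => ?_⟩
    · obtain ⟨x', rfl⟩ := hsurj x (ne_top_of_le hx le_add_self)
      obtain ⟨s, hs⟩ := hsurj _ hx
      exact (hle _ _).1 (h x' s ((hadd _ _ _).2 hs.symm) ((hle _ _).2 (hs ▸ hbx)))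
    · rw [hadd] at hs
      exact (hle _ _).2 (h _ (hs ▸ hne s) (hs ▸ (hle _ _).1 hbs))
  have hocs : ∀ a b, orthSet add zero {a} = orthSet add zero {b} ↔ oc {ι a} = oc {ι b} := by
    intro a b
    rw [← Set.image_singleton, ← Set.image_singleton (f := ι) (a := b)]
    constructor
    · intro h
      ext t
      by_cases ht : t = ⊤
      · exact ⟨fun h => (h.1 ht).elim, fun h => (h.1 ht).elim⟩
      · obtain ⟨s, rfl⟩ := hsurj t ht
        rw [← horthSet, ← horthSet, h]
    · intro h
      ext s
      rw [horthSet, horthSet, h]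
  have hassoc : ∀ a b c d, (∃ x, add a b x ∧ add x c d) ↔ ι a + ι b + ι c = ι d := by
    intro a b c d
    constructor
    · rintro ⟨x, h1, h2⟩
      rw [(hadd _ _ _).1 h1, (hadd _ _ _).1 h2]
    · intro h
      obtain ⟨x, hx⟩ := hsurj (ι a + ι b) (ne_top_of_le (hne d) (h ▸ le_self_add))
      exact ⟨x, (hadd _ _ _).2 hx.symm, (hadd _ _ _).2 (hx ▸ h)⟩
  have hcomm : ∀ a b c, add a b c ↔ add b a c := by
    intro a b c
    rw [hadd, hadd, add_comm]
  constructor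
  · constructor
    · intro a b c c' h h'
      exact hinj (((hadd _ _ _).1 h).symm.trans ((hadd _ _ _).1 h'))
    · intro a b c d
      have : (∃ y, add b c y ∧ add a y d) ↔ ∃ y, add b c y ∧ add y a d := by
        simp only [hcomm a]
      rw [this, hassoc, hassoc, add_comm (ι b + ι c), add_assoc]
    · exact hcomm
    · intro a
      rw [hadd, h0, add_zero]
  · intro a₀ a₁ b₀ b₁ s ha hb
    rw [hadd] at ha hb
    obtain ⟨c₀₀, c₀₁, c₁₀, c₁₁, h1, h2, h3, h4⟩ :=
      refinement _ _ _ _ (ha.trans hb.symm) (ha ▸ hne s)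
    obtain ⟨d₀₀, rfl⟩ := hsurj c₀₀ (ne_top_of_le (hne a₀) (h1 ▸ le_self_add))
    obtain ⟨d₀₁, rfl⟩ := hsurj c₀₁ (ne_top_of_le (hne a₀) (h1 ▸ le_add_self))
    obtain ⟨d₁₀, rfl⟩ := hsurj c₁₀ (ne_top_of_le (hne a₁) (h2 ▸ le_self_add))
    obtain ⟨d₁₁, rfl⟩ := hsurj c₁₁ (ne_top_of_le (hne a₁) (h2 ▸ le_add_self))
    exact ⟨d₀₀, d₀₁, d₁₀, d₁₁, (hadd _ _ _).2 h1, (hadd _ _ _).2 h2, (hadd _ _ _).2 h3,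
      (hadd _ _ _).2 h4⟩
  · intro a b hab hba
    exact hinj (le_antisymm ((hle _ _).1 hab) ((hle _ _).1 hba))
  · intro X hX
    obtain ⟨m, hm⟩ := exists_isGLB (hX.image ι) (by rintro _ ⟨x, -, rfl⟩; exact hne x)
    obtain ⟨x₀, hx₀⟩ := hX
    obtain ⟨m, rfl⟩ := hsurj m (ne_top_of_le (hne x₀) (hm.1 ⟨x₀, hx₀, rfl⟩))
    refine ⟨m, fun x hx => (hle _ _).2 (hm.1 ⟨x, hx, rfl⟩), fun n hn => (hle _ _).2 (hm.2 ?_)⟩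
    rintro _ ⟨x, hx, rfl⟩
    exact (hle _ _).1 (hn x hx)
  · intro x y
    obtain ⟨X, h1, h2⟩ := comparability (hne x) (hne y)
    refine ⟨p X, p (oc X), hpp X, hcompl X, ?_, ?_⟩
    · rw [hle, hp, hp]; exact h1
    · rw [hle, hp, hp]; exact h2
  · intro a b
    obtain ⟨X, hX, hmax⟩ := exists_largest_band (hne a) (hne b)
    refine ⟨p X, hpp X, by rw [hle, hp, hp]; exact hX, fun q hq hqab => ?_⟩
    obtain ⟨Y, hY⟩ := hall q hq
    rw [hle, hY, hY] at hqab
    funext s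
    exact hinj (by rw [Function.comp, hY, hp, hY, off_off_of_subset (hmax Y hqab) (hne s)])
  · intro a
    obtain ⟨x, y, hxy, hx, hy⟩ := exists_dFin_add_pInf (hne a)
    obtain ⟨x, rfl⟩ := hsurj x (ne_top_of_le (hne a) (hxy ▸ le_self_add))
    obtain ⟨y, rfl⟩ := hsurj y (ne_top_of_le (hne a) (hxy ▸ le_add_self))
    exact ⟨x, y, (hadd _ _ _).2 hxy, fun w hw => hinj ((hx _ ((hadd _ _ _).1 hw)).trans h0.symm),
      (hpinf _).2 hy⟩
  · intro a b _ hb hab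
    obtain ⟨m, ⟨hmt, hm1, hm2, hm3⟩, hmin⟩ :=
      exists_least (hne b) ((hpinf b).1 hb) ((hrem a b).1 hab)
    obtain ⟨m, rfl⟩ := hsurj m hmt
    refine ⟨m, ⟨(hpinf m).2 hm1, (hrem a m).2 hm2, (hocs m b).2 hm3⟩, ?_⟩
    rintro x ⟨h1, h2, h3⟩
    exact (hle _ _).2 (hmin _ (hne x) ((hpinf x).1 h1) ((hrem a x).1 h2) ((hocs x b).1 h3))

end DimensionMonoid

/-- For every espalier `(L, ≤, perp, sim)`, the quotient of `L` by `sim`, with the partial addition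
`Δ(a) + Δ(b) = Δ(a ⊕ b)`, is a continuous dimension scale with zero element `Δ(0)`. -/
theorem theoremA {L : Type*} [PartialOrder L] (perp : L → L → Prop) (sim : Setoid L)
    (hL : IsEspalier perp sim) :
    ∃ z : L, IsBot z ∧
      PartialMon.IsContinuousDimensionScale (dimAdd perp sim) (Quotient.mk sim z) := by
  obtain ⟨z, hz⟩ := hL.exists_isBot
  let := hL.dimensionMonoid hz
  refine ⟨z, hz, DimensionMonoid.isContinuousDimensionScale (fun s => (some s : Option (Quotient sim)))
    (Option.some_injective _) (fun s => Option.some_ne_none s)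
    (fun t ht => (Option.ne_none_iff_exists.1 ht)) (fun a b c => ?_) rfl⟩
  refine Iff.trans ?_ hL.optAdd_eq_some.symm
  exact ⟨fun h => ⟨a, b, rfl, rfl, h⟩, by rintro ⟨_, _, h1, h2, h⟩; cases h1; cases h2; exact h⟩
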